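/- Let $k$ be a commutative ring and let $\mathcal{A}=(A=\bigoplus_{i\in\mathbb{Z}}A^i,d)$ be a differential graded $k$-algebra (with $d$ of degree $+1$) such that $A^i=0$ for $i<0$, the ring $A^0$ is semisimple, and $d(A^0)=0$. Let $(L_x)_{x\in W}$ be a system of representatives of the isomorphism classes of simple right $A^0$-modules. Regard each $L_x$ as concentrated in degree $0$ with zero differential, and let $\hat L_x=L_x\otimes_{A^0}\mathcal{A}$, a dg right $\mathcal{A}$-module with differential $l\otimes a\mapsto l\otimes da$. Let $\mathrm{dgMod}(\mathcal{A})$ be the category of dg right $\mathcal{A}$-modules and $\mathrm{dgHot}(\mathcal{A})$ its homotopy category, which is triangulated with the shift $\{1\}$, where $(\{n\}M)^i=M^{i+n}$ and $d_{\{n\}M}=(-1)^n d_M$, and with the triangles isomorphic to standard mapping cone triangles as distinguished triangles. Consider two full subcategories of $\mathrm{dgHot}(\mathcal{A})$: - $\mathrm{dgPrae}$ is the smallest strict (i.e. closed under isomorphisms) full triangulated subcategory of $\mathrm{dgHot}(\mathcal{A})$ that contains all $\hat L_x$, $x\in W$. - $\mathrm{dgFilt}$ has as objects the dg modules $M$ that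 admit a finite filtration $0=F_0\subset F_1\subset\dots\subset F_n=M$ by dg submodules such that $F_i/F_{i-1}\cong\{l_i\}\hat L_{x_i}$ in $\mathrm{dgMod}(\mathcal{A})$ for $1\le i\le n$, for some $x_1,\dots,x_n\in W$ and integers $l_1\ge l_2\ge\dots\ge l_n$ (with $n\ge 0$). Then every object of $\mathrm{dgPrae}$ is isomorphic in $\mathrm{dgHot}(\mathcal{A})$ (i.e. homotopy equivalent) to an object of $\mathrm{dgFilt}$. Moreover $\mathrm{dgFilt}\subset\mathrm{dgPrae}$, and this inclusion is an equivalence of categories. -/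

import Mathlib

open CategoryTheory

universe u v

section InternalGrading

variable {M : Type v} [AddCommGroup M]

/-- The projection of an internally `ℤ`-graded abelian group onto its component of degree `i`. -/
noncomputable def gradedProj {gr : ℤ → AddSubgroup M} (h : DirectSum.IsInternal gr) (i : ℤ) :
    M →+ M :=
  (gr i).subtype.comp
    ((DFinsupp.evalAddMonoidHom i).comp
      (AddEquiv.ofBijective (DirectSum.coeAddMonoidHom gr) h).symm.toAddMonoidHom)

theorem gradedProj_mem {gr : ℤ → AddSubgroup M} (h : DirectSum.IsInternal gr) (i : ℤ) (x : M) :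
    gradedProj h i x ∈ gr i :=
  SetLike.coe_mem _

theorem gradedProj_coe {gr : ℤ → AddSubgroup M} (h : DirectSum.IsInternal gr) (i : ℤ)
    (v : DirectSum ℤ fun i => gr i) :
    gradedProj h i (DirectSum.coeAddMonoidHom gr v) = v i := by
  have : (AddEquiv.ofBijective (DirectSum.coeAddMonoidHom gr) h).symm
      (DirectSum.coeAddMonoidHom gr v) = v :=
    (AddEquiv.ofBijective (DirectSum.coeAddMonoidHom gr) h).symm_apply_apply v
  change (((AddEquiv.ofBijective (DirectSum.coeAddMonoidHom gr) h).symm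
      (DirectSum.coeAddMonoidHom gr v)) i : M) = v i
  rw [this]

theorem gradedProj_of_mem {gr : ℤ → AddSubgroup M} (h : DirectSum.IsInternal gr) {i : ℤ} {x : M}
    (hx : x ∈ gr i) : gradedProj h i x = x := by
  have := gradedProj_coe h i (DirectSum.of (fun i => gr i) i ⟨x, hx⟩)
  rw [DirectSum.coeAddMonoidHom_of, DirectSum.of_eq_same] at this
  exact this

theorem gradedProj_of_mem_ne {gr : ℤ → AddSubgroup M} (h : DirectSum.IsInternal gr) {i j : ℤ}
    (hij : i ≠ j) {x : M} (hx : x ∈ gr j) : gradedProj h i x = 0 := by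
  have := gradedProj_coe h i (DirectSum.of (fun i => gr i) j ⟨x, hx⟩)
  rw [DirectSum.coeAddMonoidHom_of, DirectSum.of_eq_of_ne _ _ _ hij] at this
  exact this

theorem mem_iSup_of_isInternal {gr : ℤ → AddSubgroup M} (h : DirectSum.IsInternal gr) (x : M) :
    x ∈ ⨆ i, gr i := by
  obtain ⟨v, rfl⟩ := h.2 x
  induction v using DirectSum.induction_on with
  | zero => simp
  | of i x =>
    rw [DirectSum.coeAddMonoidHom_of]
    exact AddSubgroup.mem_iSup_of_mem i x.2
  | add a b ha hb => rw [map_add]; exact add_mem ha hb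

/-- A family of subgroups that generates the group and admits projections is a grading. -/
theorem isInternal_of_proj {gr : ℤ → AddSubgroup M} (p : ℤ → M →+ M)
    (hp : ∀ i, ∀ x ∈ gr i, p i x = x) (hp' : ∀ i j, i ≠ j → ∀ x ∈ gr j, p i x = 0)
    (htop : ∀ x, x ∈ ⨆ i, gr i) : DirectSum.IsInternal gr := by
  have key : ∀ (v : DirectSum ℤ fun i => gr i) (i : ℤ),
      p i (DirectSum.coeAddMonoidHom gr v) = v i := by
    intro v i
    induction v using DirectSum.induction_on with
    | zero => simp
    | of j x =>
      rw [DirectSum.coeAddMonoidHom_of]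
      by_cases hij : i = j
      · subst hij
        rw [DirectSum.of_eq_same, hp _ _ x.2]
      · rw [DirectSum.of_eq_of_ne _ _ _ hij, hp' _ _ hij _ x.2]
        rfl
    | add a b ha hb =>
      rw [map_add, map_add, ha, hb]
      rfl
  constructor
  · rw [injective_iff_map_eq_zero]
    intro v hv
    refine DFinsupp.ext fun i => Subtype.ext ?_
    rw [← key v i, hv, map_zero]
    rfl
  · intro x
    have hle : ⨆ i, gr i ≤ (DirectSum.coeAddMonoidHom gr).range := iSup_le fun i x hx =>
      ⟨DirectSum.of (fun i => gr i) i ⟨x, hx⟩, DirectSum.coeAddMonoidHom_of _ _ _⟩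
    exact hle (htop x)

end InternalGrading

/-- The additive endomorphism of `M / N` induced by an additive endomorphism of `M` that
preserves `N`. -/
def quotientEnd {R M : Type*} [Ring R] [AddCommGroup M] [Module R M] (N : Submodule R M)
    (φ : M →+ M) (h : ∀ x ∈ N, φ x ∈ N) : M ⧸ N →+ M ⧸ N :=
  QuotientAddGroup.map N.toAddSubgroup N.toAddSubgroup φ (by exact h)

theorem quotientEnd_mkQ {R M : Type*} [Ring R] [AddCommGroup M] [Module R M]
    (N : Submodule R M) (φ : M →+ M) (h : ∀ x ∈ N, φ x ∈ N) (x : M) :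
    quotientEnd N φ h (N.mkQ x) = N.mkQ (φ x) :=
  rfl

/-- A differential graded `k`-algebra structure (cohomological grading by `ℤ`) on the `k`-algebra
`A`. -/
structure DGAlgebra (k : Type u) [CommRing k] (A : Type v) [Ring A] [Algebra k A] where
  /-- the homogeneous components `A^i` -/
  gr : ℤ → Submodule k A
  gradedMonoid : SetLike.GradedMonoid gr
  isInternal : DirectSum.IsInternal gr
  /-- the differential -/
  d : A →ₗ[k] A
  d_mem : ∀ (i : ℤ), ∀ a ∈ gr i, d a ∈ gr (i + 1)
  d_d : ∀ a, d (d a) = 0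
  leibniz : ∀ (i : ℤ), ∀ a ∈ gr i, ∀ b,
    d (a * b) = d a * b + ((i.negOnePow : ℤˣ) : ℤ) • (a * d b)

section

variable {k : Type u} [CommRing k] {A : Type v} [Ring A] [Algebra k A]

instance (𝒜 : DGAlgebra k A) : SetLike.GradedMonoid 𝒜.gr := 𝒜.gradedMonoid

/-- The ring `A^0`. -/
abbrev DGAlgebra.degZero (𝒜 : DGAlgebra k A) : Type v := 𝒜.gr 0

/-- The conditions: `A` is positively graded, `A^0` is semisimple, and `d(A^0) = 0`. -/
structure DGAlgebra.IsPositiveSemisimple (𝒜 : DGAlgebra k A) : Prop where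
  gr_neg : ∀ i : ℤ, i < 0 → 𝒜.gr i = ⊥
  semisimple : IsSemisimpleRing 𝒜.degZero
  d_degZero : ∀ a ∈ 𝒜.gr 0, 𝒜.d a = 0

/-- A dg right module over the dg algebra `𝒜`; right `A`-modules are modules over `Aᵐᵒᵖ`, so that
`m a` is `MulOpposite.op a • m`. (The `k`-module structure is the one coming from `k → A`, whose
image lies in `A^0` and is killed by `d`; hence components are `k`-submodules and the differential
is `k`-linear.) -/
structure DGModule (𝒜 : DGAlgebra k A) where
  /-- the underlying abelian group -/
  carrier : Type v
  [addCommGroup : AddCommGroup carrier]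
  [module : Module Aᵐᵒᵖ carrier]
  /-- the homogeneous components `M^i` -/
  gr : ℤ → AddSubgroup carrier
  isInternal : DirectSum.IsInternal gr
  smul_mem : ∀ (i j : ℤ), ∀ m ∈ gr i, ∀ a ∈ 𝒜.gr j, MulOpposite.op a • m ∈ gr (i + j)
  /-- the differential -/
  d : carrier →+ carrier
  d_mem : ∀ (i : ℤ), ∀ m ∈ gr i, d m ∈ gr (i + 1)
  d_d : ∀ m, d (d m) = 0
  leibniz : ∀ (i : ℤ), ∀ m ∈ gr i, ∀ a : A,
    d (MulOpposite.op a • m) =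
      MulOpposite.op a • d m + ((i.negOnePow : ℤˣ) : ℤ) • (MulOpposite.op (𝒜.d a) • m)

namespace DGModule

attribute [instance] DGModule.addCommGroup DGModule.module

variable {𝒜 : DGAlgebra k A}

instance : CoeSort (DGModule 𝒜) (Type v) := ⟨DGModule.carrier⟩

/-- The projection `M → M^i`, as an endomorphism of `M`. -/
noncomputable def proj (M : DGModule 𝒜) (i : ℤ) : M →+ M := gradedProj M.isInternal i

/-- Morphisms of dg modules: `A`-linear maps of degree zero commuting with the differentials. -/
@[ext]
structure Hom (M N : DGModule 𝒜) where
  /-- the underlying linear map -/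
  toLin : M →ₗ[Aᵐᵒᵖ] N
  map_gr : ∀ (i : ℤ), ∀ m ∈ M.gr i, toLin m ∈ N.gr i
  map_d : ∀ m, toLin (M.d m) = N.d (toLin m)

/-- The category `dgMod(𝒜)` of dg modules. -/
instance : Category (DGModule 𝒜) where
  Hom M N := Hom M N
  id M := ⟨LinearMap.id, fun _ _ h => h, fun _ => rfl⟩
  comp f g := ⟨g.toLin.comp f.toLin, fun i m h => g.map_gr i _ (f.map_gr i m h), fun m => by
    simp [f.map_d, g.map_d]⟩

/-- The underlying linear map of a morphism in `dgMod(𝒜)`. -/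
def lin {M N : DGModule 𝒜} (f : M ⟶ N) : M →ₗ[Aᵐᵒᵖ] N := Hom.toLin f

@[ext]
theorem hom_ext {M N : DGModule 𝒜} {f g : M ⟶ N} (h : lin f = lin g) : f = g := Hom.ext h

/-- Two morphisms `f`, `g` are homotopic if `f - g = d h + h d` for some `A`-linear map `h` of
degree `-1`. -/
def Homotopic : HomRel (DGModule 𝒜) := fun M N f g =>
  ∃ h : M →ₗ[Aᵐᵒᵖ] N, (∀ (i : ℤ), ∀ m ∈ M.gr i, h m ∈ N.gr (i - 1)) ∧
    ∀ m, lin f m - lin g m = N.d (h m) + h (M.d m)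

instance : Congruence (Homotopic (𝒜 := 𝒜)) where
  equivalence := by
    intro X Y
    refine ⟨fun f => ⟨0, fun _ _ _ => zero_mem _, fun m => by simp⟩, ?_, ?_⟩
    · rintro f g ⟨h, hd, hh⟩
      refine ⟨-h, fun i m hm => neg_mem (hd i m hm), fun m => ?_⟩
      rw [← neg_sub, hh]
      simp only [LinearMap.neg_apply, map_neg]
      abel
    · rintro f g e ⟨h, hd, hh⟩ ⟨h', hd', hh'⟩
      refine ⟨h + h', fun i m hm => add_mem (hd i m hm) (hd' i m hm), fun m => ?_⟩
      rw [← sub_add_sub_cancel _ (lin g m), hh, hh']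
      simp only [LinearMap.add_apply, map_add]
      abel
  comp_left := by
    rintro X Y Z f g g' ⟨h, hd, hh⟩
    refine ⟨h.comp (lin f), fun i m hm => hd i _ (f.map_gr i m hm), fun m => ?_⟩
    have h1 : lin f (X.d m) = Y.d (lin f m) := f.map_d m
    simp only [LinearMap.comp_apply, h1]
    exact hh _
  comp_right := by
    rintro X Y Z f f' g ⟨h, hd, hh⟩
    refine ⟨(lin g).comp h, fun i m hm => g.map_gr _ _ (hd i m hm), fun m => ?_⟩
    have h1 : ∀ y, lin g (Y.d y) = Z.d (lin g y) := g.map_d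
    have h2 : lin (f ≫ g) m - lin (f' ≫ g) m = lin g (lin f m - lin f' m) :=
      (map_sub (lin g) _ _).symm
    rw [h2, hh, map_add, h1]
    rfl

/-- The shift `{n}M`, with `({n}M)^i = M^(i+n)` and differential `(-1)^n d`. -/
def shift (n : ℤ) (M : DGModule 𝒜) : DGModule 𝒜 where
  carrier := M
  gr i := M.gr (i + n)
  isInternal := by
    refine isInternal_of_proj (fun i => M.proj (i + n))
      (fun i x hx => gradedProj_of_mem _ hx)
      (fun i j hij x hx => gradedProj_of_mem_ne _ (by omega) hx) (fun x => ?_)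
    refine (iSup_le fun i => ?_ : ⨆ i, M.gr i ≤ ⨆ i, M.gr (i + n))
      (mem_iSup_of_isInternal M.isInternal x)
    exact le_iSup_of_le (i - n) (le_of_eq (by rw [sub_add_cancel]))
  smul_mem i j m hm a ha := by
    have := M.smul_mem (i + n) j m hm a ha
    rwa [add_right_comm] at this
  d := ((n.negOnePow : ℤˣ) : ℤ) • M.d
  d_mem i m hm := by
    have := M.d_mem (i + n) m hm
    rw [add_right_comm] at this
    exact zsmul_mem this _
  d_d m := by simp [M.d_d]
  leibniz i m hm a := by
    have := M.leibniz (i + n) m hm a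
    simp only [AddMonoidHom.smul_apply, this, smul_add, Int.negOnePow_add, Units.val_mul]
    congr 1
    · exact smul_comm _ _ _
    · rw [smul_smul, mul_left_comm, ← Units.val_mul n.negOnePow, ← Int.negOnePow_add,
        Int.negOnePow_even _ (Even.add_self n), Units.val_one, mul_one]

/-- The shift functor `{n}` on `dgMod(𝒜)`. -/
def shiftFunctor (n : ℤ) : DGModule 𝒜 ⥤ DGModule 𝒜 where
  obj := shift n
  map {M N} f :=
    { toLin := (lin f : M →ₗ[Aᵐᵒᵖ] N)
      map_gr := fun i m hm => f.map_gr (i + n) m hm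
      map_d := fun m => by
        have h1 : ∀ y : M, lin f (((n.negOnePow : ℤˣ) : ℤ) • M.d y) =
            ((n.negOnePow : ℤˣ) : ℤ) • N.d (lin f y) := fun y => by
          have h2 : lin f (M.d y) = N.d (lin f y) := f.map_d y
          rw [map_zsmul, h2]
        exact h1 m }

/-- The mapping cone `C(f) = Y ⊕ {1}X` with differential `(y, x) ↦ (d y + f x, - d x)`. -/
def cone {X Y : DGModule 𝒜} (f : X ⟶ Y) : DGModule 𝒜 where
  carrier := Y × X
  gr i := (Y.gr i).prod (X.gr (i + 1))
  isInternal := by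
    have hX := (shift 1 X).isInternal
    refine isInternal_of_proj
      (fun i => AddMonoidHom.prodMap (Y.proj i) ((shift 1 X).proj i)) ?_ ?_ ?_
    · rintro i ⟨y, x⟩ ⟨hy, hx⟩
      exact Prod.ext (gradedProj_of_mem _ hy) (gradedProj_of_mem hX hx)
    · rintro i j hij ⟨y, x⟩ ⟨hy, hx⟩
      exact Prod.ext (gradedProj_of_mem_ne _ hij hy) (gradedProj_of_mem_ne hX hij hx)
    · rintro ⟨y, x⟩
      have h1 : ⨆ i, Y.gr i ≤
          (⨆ i, (Y.gr i).prod (X.gr (i + 1))).comap (AddMonoidHom.inl Y X) :=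
        iSup_le fun i y hy => AddSubgroup.mem_iSup_of_mem i ⟨hy, zero_mem _⟩
      have h2 : ⨆ i, X.gr (i + 1) ≤
          (⨆ i, (Y.gr i).prod (X.gr (i + 1))).comap (AddMonoidHom.inr Y X) :=
        iSup_le fun i x hx => AddSubgroup.mem_iSup_of_mem i ⟨zero_mem _, hx⟩
      have h3 : (y, (0 : X)) ∈ ⨆ i, (Y.gr i).prod (X.gr (i + 1)) :=
        h1 (mem_iSup_of_isInternal Y.isInternal y)
      have h4 : ((0 : Y), x) ∈ ⨆ i, (Y.gr i).prod (X.gr (i + 1)) :=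
        h2 (mem_iSup_of_isInternal hX x)
      have := add_mem h3 h4
      rwa [Prod.mk_add_mk, add_zero, zero_add] at this
  smul_mem i j m hm a ha :=
    ⟨Y.smul_mem i j _ hm.1 a ha, (shift 1 X).smul_mem i j _ hm.2 a ha⟩
  d := AddMonoidHom.prod
    (Y.d.comp (AddMonoidHom.fst Y X) + (lin f).toAddMonoidHom.comp (AddMonoidHom.snd Y X))
    (-(X.d.comp (AddMonoidHom.snd Y X)))
  d_mem i m hm :=
    ⟨add_mem (Y.d_mem i _ hm.1) (f.map_gr _ _ hm.2), (X.gr _).neg_mem (X.d_mem _ _ hm.2)⟩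
  d_d m := by
    have h1 : lin f (X.d m.2) = Y.d (lin f m.2) := f.map_d m.2
    refine Prod.ext ?_ ?_
    · simp [Y.d_d, h1]
    · simp [X.d_d]
  leibniz i m hm a := by
    have h1 := Y.leibniz i _ hm.1 a
    have h2 := X.leibniz (i + 1) _ hm.2 a
    refine Prod.ext ?_ ?_
    · simp [h1]
      abel
    · simp [h2, Int.negOnePow_succ]
      abel

/-- The canonical morphism `Y → C(f)`. -/
def coneInl {X Y : DGModule 𝒜} (f : X ⟶ Y) : Y ⟶ cone f where
  toLin := LinearMap.inl Aᵐᵒᵖ Y X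
  map_gr _ _ hm := ⟨hm, zero_mem _⟩
  map_d m := by
    refine Prod.ext ?_ ?_
    · change Y.d m = Y.d m + lin f 0
      rw [map_zero, add_zero]
    · change (0 : X) = -X.d 0
      rw [map_zero, neg_zero]

/-- The canonical morphism `C(f) → {1}X`. -/
def coneSnd {X Y : DGModule 𝒜} (f : X ⟶ Y) : cone f ⟶ shift 1 X where
  toLin := LinearMap.snd Aᵐᵒᵖ Y X
  map_gr _ _ hm := hm.2
  map_d m := by
    change -X.d m.2 = (((1 : ℤ).negOnePow : ℤˣ) : ℤ) • X.d m.2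
    simp

end DGModule

/-- A dg submodule: a graded `A`-submodule that is stable under the differential. -/
@[ext]
structure DGSubmodule {𝒜 : DGAlgebra k A} (M : DGModule 𝒜) where
  /-- the underlying submodule -/
  sub : Submodule Aᵐᵒᵖ M
  proj_mem : ∀ (i : ℤ), ∀ m ∈ sub, M.proj i m ∈ sub
  d_mem : ∀ m ∈ sub, M.d m ∈ sub

namespace DGSubmodule

variable {𝒜 : DGAlgebra k A} {M : DGModule 𝒜}

/-- The dg module `P / N` for dg submodules `N ⊆ P` of `M` (in general, `P / (P ∩ N)`). -/
noncomputable def subquotient (N P : DGSubmodule M) : DGModule 𝒜 where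
  carrier := P.sub ⧸ N.sub.submoduleOf P.sub
  gr i := ((M.gr i).comap P.sub.subtype.toAddMonoidHom).map
    (N.sub.submoduleOf P.sub).mkQ.toAddMonoidHom
  isInternal := by
    refine isInternal_of_proj (fun i => quotientEnd _
      (((M.proj i).comp P.sub.subtype.toAddMonoidHom).codRestrict P.sub
        (fun x => P.proj_mem i _ x.2)) (fun x hx => N.proj_mem i _ hx)) ?_ ?_ ?_
    · rintro i _ ⟨x, hx, rfl⟩
      exact congrArg (N.sub.submoduleOf P.sub).mkQ (Subtype.ext (gradedProj_of_mem _ hx))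
    · rintro i j hij _ ⟨x, hx, rfl⟩
      exact (congrArg (N.sub.submoduleOf P.sub).mkQ
        (Subtype.ext (gradedProj_of_mem_ne _ hij hx))).trans (map_zero _)
    · intro x
      obtain ⟨x, rfl⟩ := (N.sub.submoduleOf P.sub).mkQ_surjective x
      classical
      obtain ⟨v, hv⟩ := M.isInternal.2 x
      have hc : ∀ i, (v i : M) ∈ P.sub := fun i => by
        rw [← gradedProj_coe M.isInternal i v, hv]
        exact P.proj_mem i _ x.2
      have hs : x = ∑ i ∈ DFinsupp.support v, (⟨v i, hc i⟩ : P.sub) := by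
        refine Subtype.ext ?_
        rw [← hv, DirectSum.coeAddMonoidHom_eq_dfinsuppSum, DFinsupp.sum]
        simp
      rw [hs, map_sum]
      exact sum_mem fun i _ => AddSubgroup.mem_iSup_of_mem i ⟨_, (v i).2, rfl⟩
  smul_mem := by
    rintro i j _ ⟨x, hx, rfl⟩ a ha
    exact ⟨MulOpposite.op a • x, M.smul_mem i j _ hx a ha, map_smul (N.sub.submoduleOf P.sub).mkQ _ _⟩
  d := quotientEnd _
      ((M.d.comp P.sub.subtype.toAddMonoidHom).codRestrict P.sub
        (fun x => P.d_mem _ x.2)) (fun x hx => N.d_mem _ hx)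
  d_mem := by
    rintro i _ ⟨x, hx, rfl⟩
    exact ⟨⟨M.d x, P.d_mem _ x.2⟩, M.d_mem i _ hx, rfl⟩
  d_d m := by
    obtain ⟨x, rfl⟩ := (N.sub.submoduleOf P.sub).mkQ_surjective m
    exact (congrArg (N.sub.submoduleOf P.sub).mkQ
      (Subtype.ext (M.d_d x) : (⟨M.d (M.d x), P.d_mem _ (P.d_mem _ x.2)⟩ : P.sub) = 0)).trans
        (map_zero _)
  leibniz := by
    rintro i _ ⟨x, hx, rfl⟩ a
    exact congrArg (N.sub.submoduleOf P.sub).mkQ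
      (Subtype.ext (M.leibniz i _ hx a) :
        (⟨M.d (MulOpposite.op a • (x : M)), P.d_mem _ (P.sub.smul_mem _ x.2)⟩ : P.sub) =
          MulOpposite.op a • ⟨M.d x, P.d_mem _ x.2⟩ +
            ((i.negOnePow : ℤˣ) : ℤ) • (MulOpposite.op (𝒜.d a) • x))

end DGSubmodule

section ExtensionOfScalars

open TensorProduct

variable (𝒜 : DGAlgebra k A) (L : Type v) [AddCommGroup L] [Module 𝒜.degZeroᵐᵒᵖ L]

/-- The relations `l b ⊗ a = l ⊗ b a` (`l ∈ L`, `b ∈ A^0`, `a ∈ A`) that define `L ⊗_{A^0} A` as a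
quotient of `L ⊗_ℤ A`. Mathlib's tensor products carry the module structure of the left factor, so
`L ⊗_ℤ A` is written as `A ⊗[ℤ] L`, and its element `l ⊗ a` as `a ⊗ₜ l`. -/
def balancedRel : Submodule Aᵐᵒᵖ (A ⊗[ℤ] L) :=
  Submodule.span Aᵐᵒᵖ {t | ∃ (l : L) (b : 𝒜.degZero) (a : A),
    t = a ⊗ₜ[ℤ] (MulOpposite.op b • l) - ((b : A) * a) ⊗ₜ[ℤ] l}

variable {L} in
theorem mem_balancedRel_of_mem {φ : A →+ A} (hφ : ∀ b ∈ 𝒜.gr 0, ∀ a, φ (b * a) = b * φ a)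
    {t : A ⊗[ℤ] L} (ht : t ∈ balancedRel 𝒜 L) :
    TensorProduct.map φ.toIntLinearMap (LinearMap.id : L →ₗ[ℤ] L) t ∈ balancedRel 𝒜 L := by
  induction ht using Submodule.closure_induction with
  | zero => simp
  | add x y _ _ hx hy => rw [map_add]; exact add_mem hx hy
  | smul_mem c x hx =>
    obtain ⟨l, b, a, rfl⟩ := hx
    refine Submodule.subset_span ⟨l, b, φ (c • a), ?_⟩
    rw [smul_sub, TensorProduct.smul_tmul', TensorProduct.smul_tmul', map_sub,
      TensorProduct.map_tmul, TensorProduct.map_tmul]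
    have : c • ((b : A) * a) = b * (c • a) := by
      simp [MulOpposite.smul_eq_mul_unop, mul_assoc]
    rw [this]
    simp [hφ _ b.2]

/-- The projection `A → A^i`, as an endomorphism of `A`. -/
noncomputable def DGAlgebra.proj (i : ℤ) : A →+ A :=
  gradedProj (gr := fun i => (𝒜.gr i).toAddSubgroup) 𝒜.isInternal i

theorem DGAlgebra.proj_mul (i : ℤ) (b : A) (hb : b ∈ 𝒜.gr 0) (a : A) :
    𝒜.proj i (b * a) = b * 𝒜.proj i a := by
  have ha := mem_iSup_of_isInternal (gr := fun i => (𝒜.gr i).toAddSubgroup) 𝒜.isInternal a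
  have hle : ⨆ j, (𝒜.gr j).toAddSubgroup ≤
      ((𝒜.proj i).comp (AddMonoidHom.mulLeft b)).eqLocus
        ((AddMonoidHom.mulLeft b).comp (𝒜.proj i)) := by
    refine iSup_le fun j a ha => ?_
    change 𝒜.proj i (b * a) = b * 𝒜.proj i a
    have hba : b * a ∈ (𝒜.gr j).toAddSubgroup := by
      have := SetLike.mul_mem_graded hb (show a ∈ 𝒜.gr j from ha)
      rwa [zero_add] at this
    by_cases hij : i = j
    · subst hij
      exact (gradedProj_of_mem _ hba).trans (congrArg (b * ·) (gradedProj_of_mem _ ha)).symm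
    · refine (gradedProj_of_mem_ne _ hij hba).trans ?_
      have : 𝒜.proj i a = 0 := gradedProj_of_mem_ne _ hij ha
      rw [this, mul_zero]
  exact hle ha

/-- The dg module `L ⊗_{A^0} A` (extension of scalars along `A^0 ⊆ A`), for a right `A^0`-module
`L` placed in degree zero: its component of degree `i` is spanned by the `l ⊗ a` with `a ∈ A^i`,
and `d(l ⊗ a) = l ⊗ d a`. This is well defined because `d(A^0) = 0`. -/
noncomputable def DGAlgebra.hat (h𝒜 : ∀ a ∈ 𝒜.gr 0, 𝒜.d a = 0) : DGModule 𝒜 where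
  carrier := (A ⊗[ℤ] L) ⧸ balancedRel 𝒜 L
  gr i := AddSubgroup.closure
    {x | ∃ a ∈ 𝒜.gr i, ∃ l : L, x = (balancedRel 𝒜 L).mkQ (a ⊗ₜ[ℤ] l)}
  isInternal := by
    refine isInternal_of_proj (fun i => quotientEnd _
      (TensorProduct.map (𝒜.proj i).toIntLinearMap (LinearMap.id : L →ₗ[ℤ] L)).toAddMonoidHom
      (fun t ht => mem_balancedRel_of_mem 𝒜 (𝒜.proj_mul i) ht)) ?_ ?_ ?_
    · intro i x hx
      induction hx using AddSubgroup.closure_induction with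
      | mem x hx =>
        obtain ⟨a, ha, l, rfl⟩ := hx
        have : 𝒜.proj i a = a := gradedProj_of_mem _ ha
        exact congrArg (fun b => (balancedRel 𝒜 L).mkQ (b ⊗ₜ[ℤ] l)) this
      | zero => exact map_zero _
      | add x y _ _ hx hy => rw [map_add, hx, hy]
      | neg x _ hx => rw [map_neg, hx]
    · intro i j hij x hx
      induction hx using AddSubgroup.closure_induction with
      | mem x hx =>
        obtain ⟨a, ha, l, rfl⟩ := hx
        have : 𝒜.proj i a = 0 := gradedProj_of_mem_ne _ hij ha
        refine (congrArg (fun b => (balancedRel 𝒜 L).mkQ (b ⊗ₜ[ℤ] l)) this).trans ?_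
        simp only [TensorProduct.zero_tmul, map_zero]
      | zero => exact map_zero _
      | add x y _ _ hx hy => rw [map_add, hx, hy, add_zero]
      | neg x _ hx => rw [map_neg, hx, neg_zero]
    · intro x
      obtain ⟨t, rfl⟩ := (balancedRel 𝒜 L).mkQ_surjective x
      induction t using TensorProduct.induction_on with
      | zero => rw [map_zero]; exact zero_mem _
      | add x y hx hy => rw [map_add]; exact add_mem hx hy
      | tmul a l =>
        have ha := mem_iSup_of_isInternal (gr := fun i => (𝒜.gr i).toAddSubgroup)
          𝒜.isInternal a
        have hle : ⨆ j, (𝒜.gr j).toAddSubgroup ≤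
            (⨆ i, AddSubgroup.closure
              {x | ∃ a ∈ 𝒜.gr i, ∃ l : L, x = (balancedRel 𝒜 L).mkQ (a ⊗ₜ[ℤ] l)}).comap
            ((balancedRel 𝒜 L).mkQ.toAddMonoidHom.comp
              ((TensorProduct.mk ℤ A L).flip l).toAddMonoidHom) :=
          iSup_le fun j a ha => AddSubgroup.mem_iSup_of_mem j
            (AddSubgroup.subset_closure ⟨a, ha, l, rfl⟩)
        exact hle ha
  smul_mem i j m hm a ha := by
    induction hm using AddSubgroup.closure_induction with
    | mem x hx =>
      obtain ⟨b, hb, l, rfl⟩ := hx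
      refine AddSubgroup.subset_closure ⟨b * a, SetLike.mul_mem_graded hb ha, l, ?_⟩
      rw [← map_smul, TensorProduct.smul_tmul', op_smul_eq_mul]
    | zero => rw [smul_zero]; exact zero_mem _
    | add x y _ _ hx hy => rw [smul_add]; exact add_mem hx hy
    | neg x _ hx => rw [smul_neg]; exact neg_mem hx
  d := quotientEnd _
    (TensorProduct.map 𝒜.d.toAddMonoidHom.toIntLinearMap
      (LinearMap.id : L →ₗ[ℤ] L)).toAddMonoidHom
    (fun t ht => mem_balancedRel_of_mem 𝒜 (φ := 𝒜.d.toAddMonoidHom) (fun b hb a => by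
      change 𝒜.d (b * a) = b * 𝒜.d a
      rw [𝒜.leibniz 0 b hb a, h𝒜 b hb]
      simp) ht)
  d_mem i m hm := by
    induction hm using AddSubgroup.closure_induction with
    | mem x hx =>
      obtain ⟨b, hb, l, rfl⟩ := hx
      exact AddSubgroup.subset_closure ⟨𝒜.d b, 𝒜.d_mem i b hb, l, rfl⟩
    | zero => rw [map_zero]; exact zero_mem _
    | add x y _ _ hx hy => rw [map_add]; exact add_mem hx hy
    | neg x _ hx => rw [map_neg]; exact neg_mem hx
  d_d m := by
    obtain ⟨t, rfl⟩ := (balancedRel 𝒜 L).mkQ_surjective m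
    induction t using TensorProduct.induction_on with
    | zero => simp only [map_zero]
    | add x y hx hy => simp only [map_add, hx, hy, add_zero]
    | tmul a l =>
      refine (congrArg (fun b => (balancedRel 𝒜 L).mkQ (b ⊗ₜ[ℤ] l)) (𝒜.d_d a)).trans ?_
      simp only [TensorProduct.zero_tmul, map_zero]
  leibniz i m hm a := by
    induction hm using AddSubgroup.closure_induction with
    | mem x hx =>
      obtain ⟨b, hb, l, rfl⟩ := hx
      refine (congrArg (fun b => (balancedRel 𝒜 L).mkQ (b ⊗ₜ[ℤ] l))
        (𝒜.leibniz i b hb a)).trans ?_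
      simp only [TensorProduct.add_tmul, map_add]
      congr 1
    | zero => simp only [smul_zero, map_zero, add_zero]
    | add x y _ _ hx hy =>
      simp only [smul_add, map_add, hx, hy]
      abel
    | neg x _ hx =>
      simp only [smul_neg, map_neg, hx, neg_add]

end ExtensionOfScalars

/-- The homotopy category `dgHot(𝒜)`: dg modules, with homotopy classes of morphisms. -/
abbrev DGHot (𝒜 : DGAlgebra k A) := CategoryTheory.Quotient (DGModule.Homotopic (𝒜 := 𝒜))

namespace DGHot

variable {𝒜 : DGAlgebra k A}

/-- The quotient functor `dgMod(𝒜) ⥤ dgHot(𝒜)`. -/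
abbrev quot : DGModule 𝒜 ⥤ DGHot 𝒜 := CategoryTheory.Quotient.functor _

/-- The shift functor `{n}` on `dgHot(𝒜)`. -/
def shiftFunctor (n : ℤ) : DGHot 𝒜 ⥤ DGHot 𝒜 :=
  CategoryTheory.Quotient.lift _ (DGModule.shiftFunctor n ⋙ quot) (by
    rintro X Y f g ⟨h, hd, hh⟩
    refine CategoryTheory.Quotient.sound _
      ⟨((n.negOnePow : ℤˣ) : ℤ) • h, fun i m hm => ?_, fun m => ?_⟩
    · have := hd (i + n) m hm
      rw [add_sub_right_comm] at this
      exact (Y.gr _).zsmul_mem this _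
    · have hs : ((n.negOnePow : ℤˣ) : ℤ) * ((n.negOnePow : ℤˣ) : ℤ) = 1 := by
        rw [← Units.val_mul, ← Int.negOnePow_add, Int.negOnePow_even _ (Even.add_self n),
          Units.val_one]
      refine (hh m).trans ?_
      change Y.d (h m) + h (X.d m) =
        ((n.negOnePow : ℤˣ) : ℤ) • Y.d (((n.negOnePow : ℤˣ) : ℤ) • h m) +
          ((n.negOnePow : ℤˣ) : ℤ) • h (((n.negOnePow : ℤˣ) : ℤ) • X.d m)
      rw [map_zsmul, map_zsmul, smul_smul, smul_smul, hs, one_smul, one_smul])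

/-- The triangle `X → Y → Z → {1}X` in `dgHot(𝒜)` is distinguished: it is isomorphic to the
standard triangle `X' → Y' → C(φ) → {1}X'` of a morphism `φ` of dg modules. -/
def IsDistinguished {X Y Z : DGHot 𝒜} (f : X ⟶ Y) (g : Y ⟶ Z)
    (h : Z ⟶ (shiftFunctor 1).obj X) : Prop :=
  ∃ (X' Y' : DGModule 𝒜) (φ : X' ⟶ Y') (a : X ≅ quot.obj X') (b : Y ≅ quot.obj Y')
    (c : Z ≅ quot.obj (DGModule.cone φ)),
    f ≫ b.hom = a.hom ≫ quot.map φ ∧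
    g ≫ c.hom = b.hom ≫ quot.map (DGModule.coneInl φ) ∧
    h ≫ (shiftFunctor 1).map a.hom = c.hom ≫ quot.map (DGModule.coneSnd φ)

/-- The full subcategory of `dgHot(𝒜)` on the objects satisfying `P` is a strict full triangulated
subcategory: it contains zero objects, and is closed under isomorphisms, shifts, and the third
vertex of a distinguished triangle. -/
structure IsStrictTriangulated (P : ObjectProperty (DGHot 𝒜)) : Prop where
  zero : P.ContainsZero
  iso : P.IsClosedUnderIsomorphisms
  shift : ∀ (n : ℤ) (X : DGHot 𝒜), P X → P ((shiftFunctor n).obj X)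
  third : ∀ {X Y Z : DGHot 𝒜} (f : X ⟶ Y) (g : Y ⟶ Z) (h : Z ⟶ (shiftFunctor 1).obj X),
    IsDistinguished f g h → P X → P Y → P Z

end DGHot

/-- `(L x)` for `x ∈ W` is a system of representatives of the isomorphism classes of simple right
modules over the ring `R`. -/
structure IsSimpleSystem (R : Type v) [Ring R] {W : Type*} (L : W → Type v)
    [∀ x, AddCommGroup (L x)] [∀ x, Module Rᵐᵒᵖ (L x)] : Prop where
  simple : ∀ x, IsSimpleModule Rᵐᵒᵖ (L x)
  eq_of_iso : ∀ x y, Nonempty (L x ≃ₗ[Rᵐᵒᵖ] L y) → x = y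
  exists_iso : ∀ (S : Type v) [AddCommGroup S] [Module Rᵐᵒᵖ S], IsSimpleModule Rᵐᵒᵖ S →
    ∃ x, Nonempty (S ≃ₗ[Rᵐᵒᵖ] L x)

section Subcategories

variable {𝒜 : DGAlgebra k A} (h𝒜 : 𝒜.IsPositiveSemisimple) {W : Type*} (L : W → Type v)
  [∀ x, AddCommGroup (L x)] [∀ x, Module 𝒜.degZeroᵐᵒᵖ (L x)]

/-- `M` admits a finite filtration `0 = F_0 ⊆ F_1 ⊆ ⋯ ⊆ F_n = M` by dg submodules with
`F_i / F_{i-1} ≅ {l_i} L̂_{x_i}` in `dgMod(𝒜)` and `l_1 ≥ ⋯ ≥ l_n`. -/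
def HasHatFiltration (M : DGModule 𝒜) : Prop :=
  ∃ (n : ℕ) (F : Fin (n + 1) → DGSubmodule M) (l : Fin n → ℤ) (x : Fin n → W),
    (F 0).sub = ⊥ ∧ (F (Fin.last n)).sub = ⊤ ∧ Antitone l ∧
    ∀ i : Fin n, (F i.castSucc).sub ≤ (F i.succ).sub ∧
      Nonempty (DGSubmodule.subquotient (F i.castSucc) (F i.succ) ≅
        DGModule.shift (l i) (𝒜.hat (L (x i)) h𝒜.d_degZero))

/-- The objects of `dgFilt(𝒜)`, as a full subcategory of `dgHot(𝒜)`. -/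
def dgFilt : ObjectProperty (DGHot 𝒜) := fun X => HasHatFiltration h𝒜 L X.as

/-- The objects of `dgPrae(𝒜)`, the smallest strict full triangulated subcategory of `dgHot(𝒜)`
that contains all `L̂_x`. -/
def dgPrae : ObjectProperty (DGHot 𝒜) := fun X =>
  ∀ P : ObjectProperty (DGHot 𝒜), DGHot.IsStrictTriangulated P →
    (∀ x, P (DGHot.quot.obj (𝒜.hat (L x) h𝒜.d_degZero))) → P X

end Subcategories

end

/-! The order of the integers `l_i` in a filtration can be repaired up to homotopy. Since `A^0` is
semisimple, every `A^0`-module is projective, so an extension with quotient `{l}L̂_x` splits as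
graded modules and is therefore a mapping cone of a morphism from `{l-1}L̂_x`. Objects of `dgFilt`
are thus the modules built from zero by attaching such cells with decreasing `l`; this is
`IsCellular`, and `HasHatFiltration.exists_isCellular` and `IsCellular.hasHatFiltration` translate
both ways.

It remains to see that modules homotopy equivalent to a cellular one form a triangulated
subcategory. A cone over a cellular source is built cell by cell (`exists_iso_cone_cone`), so it
suffices to attach one cell `S` of level `l` to a cellular `N`
(`IsCellular.isHomotopyCellular_cone`). If the last cell `T` of `N` has level `l' < l`, the order is
wrong. The composite `S ⟶ N ⟶ {1}T` then goes from `{l-1}L̂_x` to `{l'}L̂_y` with `l' ≤ l - 1`. As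
`A` vanishes in negative degrees, Schur's lemma makes it zero or an isomorphism
(`DGAlgebra.eq_zero_or_isIso`). If it is zero, `S` can be attached before `T`
(`nonempty_iso_cone_swap`); if it is an isomorphism, the two cells cancel
(`nonempty_iso_quot_cone_of_isIso`). -/

/-! ### Morphisms, shifts and the zero object -/

namespace DGModule

variable {k : Type u} [CommRing k] {A : Type v} [Ring A] [Algebra k A] {𝒜 : DGAlgebra k A}

/-- A degree zero linear map commuting with the differentials, as a morphism of dg modules. -/
def homMk {M N : DGModule 𝒜} (f : M →ₗ[Aᵐᵒᵖ] N) (hgr : ∀ i, ∀ m ∈ M.gr i, f m ∈ N.gr i)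
    (hd : ∀ m, f (M.d m) = N.d (f m)) : M ⟶ N :=
  Hom.mk f hgr hd

@[simp]
theorem lin_id (M : DGModule 𝒜) (m : M) : lin (𝟙 M) m = m := rfl

@[simp]
theorem lin_comp {M N P : DGModule 𝒜} (f : M ⟶ N) (g : N ⟶ P) (m : M) :
    lin (f ≫ g) m = lin g (lin f m) := rfl

theorem lin_d {M N : DGModule 𝒜} (f : M ⟶ N) (m : M) : lin f (M.d m) = N.d (lin f m) :=
  f.map_d m

theorem lin_mem {M N : DGModule 𝒜} (f : M ⟶ N) {i : ℤ} {m : M} (hm : m ∈ M.gr i) :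
    lin f m ∈ N.gr i :=
  f.map_gr i m hm

theorem ext_apply {M N : DGModule 𝒜} {f g : M ⟶ N} (h : ∀ m, lin f m = lin g m) : f = g :=
  hom_ext (LinearMap.ext h)

theorem proj_mem (M : DGModule 𝒜) (i : ℤ) (m : M) : M.proj i m ∈ M.gr i :=
  gradedProj_mem _ _ _

theorem proj_of_mem (M : DGModule 𝒜) {i : ℤ} {m : M} (hm : m ∈ M.gr i) : M.proj i m = m :=
  gradedProj_of_mem _ hm

theorem proj_of_mem_ne (M : DGModule 𝒜) {i j : ℤ} (hij : i ≠ j) {m : M} (hm : m ∈ M.gr j) :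
    M.proj i m = 0 :=
  gradedProj_of_mem_ne _ hij hm

theorem gr_induction (M : DGModule 𝒜) {p : M → Prop} (zero : p 0)
    (add : ∀ x y, p x → p y → p (x + y)) (mem : ∀ i, ∀ m ∈ M.gr i, p m) (m : M) : p m := by
  have h := mem_iSup_of_isInternal M.isInternal m
  induction h using AddSubgroup.iSup_induction' with
  | hp i x hx => exact mem i x hx
  | h1 => exact zero
  | hadd x y _ _ hx hy => exact add x y hx hy

theorem map_proj {M N : DGModule 𝒜} (f : M →+ N) (hf : ∀ i, ∀ m ∈ M.gr i, f m ∈ N.gr i)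
    (i : ℤ) (m : M) : f (M.proj i m) = N.proj i (f m) := by
  induction m using M.gr_induction with
  | zero => simp
  | add x y hx hy => simp [hx, hy]
  | mem j m hm =>
    by_cases hij : i = j
    · subst hij
      rw [M.proj_of_mem hm, N.proj_of_mem (hf _ _ hm)]
    · rw [M.proj_of_mem_ne hij hm, N.proj_of_mem_ne hij (hf _ _ hm), map_zero]

theorem lin_proj {M N : DGModule 𝒜} (f : M ⟶ N) (i : ℤ) (m : M) :
    lin f (M.proj i m) = N.proj i (lin f m) :=
  map_proj (lin f).toAddMonoidHom (fun _ _ hm => lin_mem f hm) i m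

/-- The inverse preserves degrees automatically, because a morphism commutes with the projections to
the components. -/
theorem isIso_of_bijective {M N : DGModule 𝒜} (f : M ⟶ N) (hf : Function.Bijective (lin f)) :
    IsIso f := by
  let e := LinearEquiv.ofBijective (lin f) hf
  have he : ∀ y, lin f (e.symm y) = y := e.apply_symm_apply
  refine ⟨homMk e.symm.toLinearMap (fun i y hy => ?_) (fun y => hf.1 ?_), ?_, ?_⟩
  · change e.symm y ∈ M.gr i
    have : e.symm y = M.proj i (e.symm y) := hf.1 (by rw [lin_proj, he, N.proj_of_mem hy])
    rw [this]
    exact M.proj_mem _ _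
  · exact (he _).trans (by rw [lin_d]; exact congrArg N.d (he y).symm)
  · exact ext_apply e.symm_apply_apply
  · exact ext_apply e.apply_symm_apply

theorem nonempty_iso_of_linearEquiv {M N : DGModule 𝒜} (e : M ≃ₗ[Aᵐᵒᵖ] N)
    (hgr : ∀ i, ∀ m ∈ M.gr i, e m ∈ N.gr i) (hd : ∀ m, e (M.d m) = N.d (e m)) :
    Nonempty (M ≅ N) :=
  have := isIso_of_bijective (homMk e.toLinearMap hgr hd) e.bijective
  ⟨asIso (homMk e.toLinearMap hgr hd)⟩

theorem lin_bijective {M N : DGModule 𝒜} (e : M ≅ N) : Function.Bijective (lin e.hom) := by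
  refine Function.bijective_iff_has_inverse.2 ⟨lin e.inv, fun m => ?_, fun m => ?_⟩
  · rw [← lin_comp, e.hom_inv_id, lin_id]
  · rw [← lin_comp, e.inv_hom_id, lin_id]

theorem shift_shift (a b c : ℤ) (h : a + b = c) (M : DGModule 𝒜) :
    Nonempty (shift a (shift b M) ≅ shift c M) := by
  subst h
  refine nonempty_iso_of_linearEquiv (LinearEquiv.refl Aᵐᵒᵖ M) (fun i m hm => ?_) (fun m => ?_)
  · have hm' : m ∈ M.gr (i + a + b) := hm
    change m ∈ M.gr (i + (a + b))
    rwa [← add_assoc]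
  · change ((a.negOnePow : ℤˣ) : ℤ) • ((b.negOnePow : ℤˣ) : ℤ) • M.d m =
      (((a + b).negOnePow : ℤˣ) : ℤ) • M.d m
    rw [Int.negOnePow_add, Units.val_mul, smul_smul]

theorem shift_zero_iso (M : DGModule 𝒜) : Nonempty (shift 0 M ≅ M) := by
  refine nonempty_iso_of_linearEquiv (LinearEquiv.refl Aᵐᵒᵖ M) (fun i m hm => ?_) (fun m => ?_)
  · have hm' : m ∈ M.gr (i + 0) := hm
    rwa [add_zero] at hm'
  · change (((0 : ℤ).negOnePow : ℤˣ) : ℤ) • M.d m = M.d m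
    simp

variable (𝒜) in
/-- The zero dg module. -/
def zeroModule : DGModule 𝒜 where
  carrier := PUnit
  gr _ := ⊤
  isInternal := isInternal_of_proj (fun _ => 0) (fun _ _ _ => rfl) (fun _ _ _ _ _ => rfl)
    (fun x => (Subsingleton.elim 0 x) ▸ zero_mem _)
  smul_mem _ _ _ _ _ _ := trivial
  d := 0
  d_mem _ _ _ := trivial
  d_d _ := rfl
  leibniz _ _ _ _ := rfl

instance : Subsingleton (zeroModule 𝒜) := inferInstanceAs (Subsingleton PUnit)

/-- The zero morphism. -/
def zeroHom (M N : DGModule 𝒜) : M ⟶ N :=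
  homMk 0 (fun _ _ _ => zero_mem _) (fun _ => (map_zero N.d).symm)

theorem isZero_quot_of_subsingleton (M : DGModule 𝒜) [Subsingleton M] :
    Limits.IsZero (DGHot.quot.obj M) := by
  constructor
  · intro Y
    refine ⟨⟨⟨DGHot.quot.map (zeroHom M Y.as)⟩, fun f => ?_⟩⟩
    obtain ⟨f, rfl⟩ := (DGHot.quot (𝒜 := 𝒜)).map_surjective (Y := Y.as) f
    refine congrArg _ (ext_apply fun m => ?_)
    rw [Subsingleton.elim m 0, map_zero, map_zero]
  · intro Y
    refine ⟨⟨⟨DGHot.quot.map (zeroHom Y.as M)⟩, fun f => ?_⟩⟩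
    obtain ⟨f, rfl⟩ := (DGHot.quot (𝒜 := 𝒜)).map_surjective (X := Y.as) f
    exact congrArg _ (ext_apply fun m => Subsingleton.elim (α := M) _ _)

end DGModule

/-! ### Mapping cones and homotopy equivalence -/

namespace DGModule

variable {k : Type u} [CommRing k] {A : Type v} [Ring A] [Algebra k A] {𝒜 : DGAlgebra k A}

theorem lin_cone_eq {T X Y : DGModule 𝒜} {χ : T ⟶ X} (φ : cone χ ⟶ Y) (x : X) (t : T) :
    lin φ ((x, t) : X × T) = lin φ ((x, 0) : X × T) + lin φ ((0, t) : X × T) := by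
  refine Eq.trans (congrArg _ ?_) (map_add (lin φ) _ _)
  exact Prod.ext (add_zero x).symm (zero_add t).symm

/-- The morphism of mapping cones induced by a square that commutes up to a homotopy `s`. -/
def coneMap {X Y X' Y' : DGModule 𝒜} (φ : X ⟶ Y) (φ' : X' ⟶ Y') (a : X ⟶ X') (b : Y ⟶ Y')
    (s : X →ₗ[Aᵐᵒᵖ] Y') (hs : ∀ i, ∀ x ∈ X.gr i, s x ∈ Y'.gr (i - 1))
    (h : ∀ x, lin (φ ≫ b) x - lin (a ≫ φ') x = Y'.d (s x) + s (X.d x)) : cone φ ⟶ cone φ' :=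
  homMk (M := cone φ) (N := cone φ')
    (LinearMap.prod
      ((lin b).comp (LinearMap.fst Aᵐᵒᵖ Y X) + s.comp (LinearMap.snd Aᵐᵒᵖ Y X))
      ((lin a).comp (LinearMap.snd Aᵐᵒᵖ Y X)))
    (fun i m hm => ⟨add_mem (lin_mem b hm.1) (by
      have := hs _ _ hm.2
      rw [add_sub_cancel_right] at this
      exact this), lin_mem a hm.2⟩)
    (by
      rintro ⟨y, x⟩
      refine Prod.ext ?_ ?_
      · change lin b (Y.d y + lin φ x) + s (-X.d x) =
          Y'.d (lin b y + s x) + lin φ' (lin a x)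
        have := h x
        simp only [lin_comp] at this
        rw [map_add, map_add, map_neg, lin_d, sub_eq_iff_eq_add.1 this]
        abel
      · change lin a (-X.d x) = -X'.d (lin a x)
        rw [map_neg, lin_d])

/-- An upper triangular endomorphism of a cone whose diagonal entries are homotopic to identities
need not be homotopic to the identity, but it is homotopic to a unipotent one, which is invertible.
This replaces the five lemma for triangles. -/
theorem isIso_quot_coneMap_of_homotopic_id {X Y : DGModule 𝒜} {φ : X ⟶ Y} {a : X ⟶ X}
    {b : Y ⟶ Y} (ha : Homotopic a (𝟙 X)) (hb : Homotopic b (𝟙 Y)) (F : cone φ ⟶ cone φ)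
    (s : X →ₗ[Aᵐᵒᵖ] Y)
    (hF : ∀ (y : Y) (x : X), lin F ((y, x) : Y × X) = ((lin b y + s x, lin a x) : Y × X)) :
    IsIso (DGHot.quot.map F) := by
  obtain ⟨p, hp, hp'⟩ := ha
  obtain ⟨q, hq, hq'⟩ := hb
  -- The off-diagonal entry left after subtracting `dH + Hd` from `F`; the sign of `-p` in `H`
  -- matches the differential `-d` on the summand `X`.
  let s' : X →ₗ[Aᵐᵒᵖ] Y := s - q.comp (lin φ) + (lin φ).comp p
  let H : cone φ →ₗ[Aᵐᵒᵖ] cone φ := LinearMap.prodMap q (-p)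
  have hH : ∀ (y : Y) (x : X), H ((y, x) : Y × X) = ((q y, -p x) : Y × X) := fun _ _ => rfl
  have hHgr : ∀ i, ∀ m ∈ (cone φ).gr i, H m ∈ (cone φ).gr (i - 1) := fun i m hm =>
    ⟨hq _ _ hm.1, (X.gr _).neg_mem (by simpa [add_sub_right_comm] using hp _ _ hm.2)⟩
  let G₀ : cone φ →ₗ[Aᵐᵒᵖ] cone φ :=
    LinearMap.prod (LinearMap.fst Aᵐᵒᵖ Y X + s'.comp (LinearMap.snd Aᵐᵒᵖ Y X))
      (LinearMap.snd Aᵐᵒᵖ Y X)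
  have hG₀ : ∀ m, lin F m - G₀ m = (cone φ).d (H m) + H ((cone φ).d m) := by
    rintro ⟨y, x⟩
    rw [hF]
    refine Prod.ext ?_ ?_
    · change lin b y + s x - (y + (s x - q (lin φ x) + lin φ (p x))) =
        Y.d (q y) + lin φ (-p x) + q (Y.d y + lin φ x)
      have := hq' y
      rw [lin_id, sub_eq_iff_eq_add] at this
      rw [this, map_neg, map_add]
      abel
    · change lin a x - x = -X.d (-p x) + -p (-X.d x)
      rw [map_neg, map_neg, neg_neg, neg_neg]
      exact hp' x
  have hG₀' : ∀ m, G₀ m = lin F m - ((cone φ).d (H m) + H ((cone φ).d m)) := fun m => by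
    rw [← hG₀, sub_sub_cancel]
  -- Compatibility with degrees and differentials is inherited from `F`, since `G₀ = F - (dH + Hd)`.
  let G : cone φ ⟶ cone φ := homMk G₀
    (fun i m hm => by
      rw [hG₀']
      refine sub_mem (lin_mem F hm) (add_mem ?_ ?_)
      · simpa using (cone φ).d_mem _ _ (hHgr _ _ hm)
      · simpa using hHgr _ _ ((cone φ).d_mem _ _ hm))
    (fun m => by
      rw [hG₀', hG₀', lin_d, map_sub, map_add, (cone φ).d_d, (cone φ).d_d, map_zero, zero_add,
        add_zero])
  have : IsIso G := by
    refine isIso_of_bijective G (Function.bijective_iff_has_inverse.2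
      ⟨fun m : Y × X => ((m.1 - s' m.2, m.2) : Y × X), ?_, ?_⟩)
    · rintro ⟨y, x⟩
      exact Prod.ext (add_sub_cancel_right y (s' x)) rfl
    · rintro ⟨y, x⟩
      exact Prod.ext (sub_add_cancel y (s' x)) rfl
  have hFG : DGHot.quot.map F = DGHot.quot.map G := CategoryTheory.Quotient.sound _ ⟨H, hHgr, hG₀⟩
  rw [hFG]
  infer_instance

/-- Two morphisms of dg modules that are isomorphic in the homotopy category have isomorphic
mapping cones there. -/
theorem nonempty_iso_quot_cone {X Y X' Y' : DGModule 𝒜} (φ : X ⟶ Y) (φ' : X' ⟶ Y')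
    (a : DGHot.quot.obj X ≅ DGHot.quot.obj X') (b : DGHot.quot.obj Y ≅ DGHot.quot.obj Y')
    (h : DGHot.quot.map φ ≫ b.hom = a.hom ≫ DGHot.quot.map φ') :
    Nonempty (DGHot.quot.obj (cone φ) ≅ DGHot.quot.obj (cone φ')) := by
  obtain ⟨a₁, ha₁⟩ := DGHot.quot.map_surjective a.hom
  obtain ⟨a₂, ha₂⟩ := DGHot.quot.map_surjective a.inv
  obtain ⟨b₁, hb₁⟩ := DGHot.quot.map_surjective b.hom
  obtain ⟨b₂, hb₂⟩ := DGHot.quot.map_surjective b.inv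
  have toHomotopic : ∀ {M N : DGModule 𝒜} {f g : M ⟶ N},
      DGHot.quot.map f = DGHot.quot.map g → Homotopic f g := fun h =>
    (CategoryTheory.Quotient.functor_map_eq_iff _ _ _).1 h
  have ha : Homotopic (a₁ ≫ a₂) (𝟙 X) := toHomotopic (by
    rw [Functor.map_comp, CategoryTheory.Functor.map_id, ha₁, ha₂, a.hom_inv_id])
  have ha' : Homotopic (a₂ ≫ a₁) (𝟙 X') := toHomotopic (by
    rw [Functor.map_comp, CategoryTheory.Functor.map_id, ha₁, ha₂, a.inv_hom_id])
  have hb : Homotopic (b₁ ≫ b₂) (𝟙 Y) := toHomotopic (by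
    rw [Functor.map_comp, CategoryTheory.Functor.map_id, hb₁, hb₂, b.hom_inv_id])
  have hb' : Homotopic (b₂ ≫ b₁) (𝟙 Y') := toHomotopic (by
    rw [Functor.map_comp, CategoryTheory.Functor.map_id, hb₁, hb₂, b.inv_hom_id])
  obtain ⟨s, hs, hs'⟩ : Homotopic (φ ≫ b₁) (a₁ ≫ φ') := toHomotopic (by
    rw [Functor.map_comp, Functor.map_comp, ha₁, hb₁, h])
  obtain ⟨t, ht, ht'⟩ : Homotopic (φ' ≫ b₂) (a₂ ≫ φ) := toHomotopic (by
    rw [Functor.map_comp, Functor.map_comp, ha₂, hb₂, Iso.comp_inv_eq, Category.assoc, h,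
      Iso.inv_hom_id_assoc])
  let F := coneMap φ φ' a₁ b₁ s hs hs'
  let G := coneMap φ' φ a₂ b₂ t ht ht'
  -- Both composites are upper triangular with diagonal entries homotopic to identities.
  have h₁ : IsIso (DGHot.quot.map (F ≫ G)) :=
    isIso_quot_coneMap_of_homotopic_id ha hb (F ≫ G)
      ((lin b₂).comp s + t.comp (lin a₁)) (fun y x => by
        refine Prod.ext ?_ rfl
        change lin b₂ (lin b₁ y + s x) + t (lin a₁ x) =
          lin b₂ (lin b₁ y) + (lin b₂ (s x) + t (lin a₁ x))
        rw [map_add, add_assoc])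
  have h₂ : IsIso (DGHot.quot.map (G ≫ F)) :=
    isIso_quot_coneMap_of_homotopic_id ha' hb' (G ≫ F)
      ((lin b₁).comp t + s.comp (lin a₂)) (fun y x => by
        refine Prod.ext ?_ rfl
        change lin b₁ (lin b₂ y + t x) + s (lin a₂ x) =
          lin b₁ (lin b₂ y) + (lin b₁ (t x) + s (lin a₂ x))
        rw [map_add, add_assoc])
  rw [Functor.map_comp] at h₁ h₂
  -- Invertibility of `F ≫ G` makes `F` mono, and invertibility of `G ≫ F` makes it split epi.
  have : IsIso (DGHot.quot.map F) := by
    have := mono_of_mono (DGHot.quot.map F) (DGHot.quot.map G)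
    have := (IsSplitEpi.mk' ⟨inv (DGHot.quot.map G ≫ DGHot.quot.map F) ≫ DGHot.quot.map G,
      by simp only [Category.assoc, IsIso.inv_hom_id]⟩ : IsSplitEpi (DGHot.quot.map F))
    exact isIso_of_mono_of_isSplitEpi _
  exact ⟨asIso (DGHot.quot.map F)⟩

/-- The mapping cone only depends on the target up to isomorphism in the homotopy category. -/
theorem exists_iso_quot_cone_right {X Y Y' : DGModule 𝒜} (φ : X ⟶ Y)
    (b : DGHot.quot.obj Y ≅ DGHot.quot.obj Y') :
    ∃ φ' : X ⟶ Y', Nonempty (DGHot.quot.obj (cone φ) ≅ DGHot.quot.obj (cone φ')) := by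
  obtain ⟨φ', hφ'⟩ := DGHot.quot.map_surjective (DGHot.quot.map φ ≫ b.hom)
  exact ⟨φ', nonempty_iso_quot_cone φ φ' (Iso.refl _) b (by rw [hφ']; simp)⟩

/-- Isomorphic morphisms have isomorphic mapping cones. -/
theorem nonempty_iso_cone {X Y X' Y' : DGModule 𝒜} (φ : X ⟶ Y) (φ' : X' ⟶ Y') (a : X ≅ X')
    (b : Y ≅ Y') (h : φ ≫ b.hom = a.hom ≫ φ') : Nonempty (cone φ ≅ cone φ') := by
  let F : cone φ ⟶ cone φ' := coneMap φ φ' a.hom b.hom 0 (fun _ _ _ => zero_mem _)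
    (fun x => by rw [h, sub_self]; simp)
  have := isIso_of_bijective F (by
    have h1 : (lin F : Y × X → Y' × X') = Prod.map (lin b.hom) (lin a.hom) := by
      funext ⟨y, x⟩
      exact Prod.ext (add_zero _) rfl
    exact h1 ▸ (lin_bijective b).prodMap (lin_bijective a))
  exact ⟨asIso F⟩

/-- The mapping cone of a morphism from a subsingleton. -/
theorem nonempty_iso_cone_of_subsingleton {X Y : DGModule 𝒜} [Subsingleton X] (φ : X ⟶ Y) :
    Nonempty (Y ≅ cone φ) := by
  have := isIso_of_bijective (coneInl φ) (by
    constructor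
    · exact LinearMap.inl_injective
    · rintro ⟨y, x⟩
      exact ⟨y, Prod.ext rfl (Subsingleton.elim _ _)⟩)
  exact ⟨asIso (coneInl φ)⟩

/-- The mapping cone of a morphism from a mapping cone `C(χ : T → X)` is a mapping cone of a
morphism from `{1}T`. -/
theorem exists_iso_cone_cone {T X Y : DGModule 𝒜} (χ : T ⟶ X) (φ : cone χ ⟶ Y) :
    ∃ ψ : shift 1 T ⟶ cone (coneInl χ ≫ φ), Nonempty (cone φ ≅ cone ψ) := by
  -- Both cones live on `Y ⊕ X ⊕ T`, so `ψ` is read off from the differential of `cone φ` on `T`.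
  -- The sign of `-χ` appears because `cone φ` negates the differential of `cone χ`.
  let ψ : shift 1 T ⟶ cone (coneInl χ ≫ φ) :=
    homMk (M := shift 1 T) (N := cone (coneInl χ ≫ φ))
      (LinearMap.prod ((lin φ).comp (LinearMap.inr Aᵐᵒᵖ X T)) (-(lin χ)))
      (fun i t ht => ⟨lin_mem φ (i := i) ⟨zero_mem _, ht⟩, (X.gr _).neg_mem (lin_mem χ ht)⟩)
      (fun t => by
        change (lin φ ((0, (((1 : ℤ).negOnePow : ℤˣ) : ℤ) • T.d t) : X × T),
            -lin χ ((((1 : ℤ).negOnePow : ℤˣ) : ℤ) • T.d t)) =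
          (Y.d (lin φ ((0, t) : X × T)) + lin φ ((-lin χ t, 0) : X × T), -X.d (-lin χ t))
        have h1 : lin φ ((X.d 0 + lin χ t, -T.d t) : X × T) = Y.d (lin φ ((0, t) : X × T)) :=
          lin_d φ ((0, t) : X × T)
        rw [map_zero, zero_add, lin_cone_eq] at h1
        have h2 : lin φ ((-lin χ t, 0) : X × T) = -lin φ ((lin χ t, 0) : X × T) := by
          refine Eq.trans (congrArg (lin φ) ?_) (map_neg (lin φ) ((lin χ t, 0) : X × T))
          exact Prod.ext rfl neg_zero.symm
        rw [h2, ← h1]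
        simp only [Int.negOnePow_one, Units.val_neg, Units.val_one, neg_smul, one_smul, map_neg,
          neg_neg, add_neg_cancel_comm, Prod.mk.injEq, true_and]
        exact lin_d χ t)
  refine ⟨ψ, nonempty_iso_of_linearEquiv (M := cone φ) (N := cone ψ)
    (LinearEquiv.prodAssoc Aᵐᵒᵖ Y X T).symm (fun i m hm => ?_) ?_⟩
  · exact ⟨⟨hm.1, hm.2.1⟩, hm.2.2⟩
  · rintro ⟨y, x, t⟩
    change (((Y.d y + lin φ ((x, t) : X × T), -(X.d x + lin χ t)), - -T.d t) : (Y × X) × T) =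
      ((Y.d y + lin φ ((x, 0) : X × T) + lin φ ((0, t) : X × T), -X.d x + -lin χ t),
        -((((1 : ℤ).negOnePow : ℤˣ) : ℤ) • T.d t))
    rw [lin_cone_eq, neg_add, add_assoc]
    simp

/-- A morphism `S → C(χ)` whose composition with `C(χ) → {1}T` vanishes factors through the
target of `χ : T → X`. -/
theorem exists_eq_comp_coneInl {S T X : DGModule 𝒜} {χ : T ⟶ X} (φ : S ⟶ cone χ)
    (h : ∀ s, lin (φ ≫ coneSnd χ) s = 0) : ∃ φ' : S ⟶ X, φ = φ' ≫ coneInl χ := by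
  have h2 : ∀ s, (lin φ s : X × T).2 = 0 := h
  refine ⟨homMk ((LinearMap.fst Aᵐᵒᵖ X T).comp (lin φ)) (fun i s hs => (lin_mem φ hs).1)
    (fun s => ?_), ext_apply fun s => Prod.ext rfl (h2 s)⟩
  have h1 : (lin φ (S.d s) : X × T) = (cone χ).d (lin φ s) := lin_d φ s
  change (lin φ (S.d s) : X × T).1 = X.d (lin φ s : X × T).1
  rw [h1]
  change X.d (lin φ s : X × T).1 + lin χ (lin φ s : X × T).2 = _
  rw [h2, map_zero, add_zero]

/-- The two ways of attaching `S` and `T` to `X` agree. -/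
theorem nonempty_iso_cone_swap {S T X : DGModule 𝒜} (χ : T ⟶ X) (φ : S ⟶ X) :
    Nonempty (cone (φ ≫ coneInl χ) ≅ cone (χ ≫ coneInl φ)) := by
  let e : ((X × T) × S) ≃ₗ[Aᵐᵒᵖ] ((X × S) × T) :=
    { toFun := fun m => ((m.1.1, m.2), m.1.2)
      invFun := fun m => ((m.1.1, m.2), m.1.2)
      map_add' := fun _ _ => rfl
      map_smul' := fun _ _ => rfl
      left_inv := fun _ => rfl
      right_inv := fun _ => rfl }
  refine nonempty_iso_of_linearEquiv (M := cone (φ ≫ coneInl χ)) (N := cone (χ ≫ coneInl φ)) e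
    (fun i m hm => ⟨⟨hm.1.1, hm.2⟩, hm.1.2⟩) ?_
  rintro ⟨⟨x, t⟩, s⟩
  change (((X.d x + lin χ t + lin φ s, -S.d s), -T.d t + 0) : (X × S) × T) =
    ((X.d x + lin φ s + lin χ t, -S.d s + 0), -T.d t)
  rw [add_right_comm, add_zero, add_zero]

/-- If `S → C(χ) → {1}T` is an isomorphism, then the cone of `S → C(χ)` is homotopy equivalent to
the target of `χ : T → X`. -/
theorem nonempty_iso_quot_cone_of_isIso {S T X : DGModule 𝒜} (χ : T ⟶ X) (φ : S ⟶ cone χ)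
    (h : IsIso (φ ≫ coneSnd χ)) : Nonempty (DGHot.quot.obj (cone φ) ≅ DGHot.quot.obj X) := by
  let ρ : shift 1 T ⟶ S := inv (φ ≫ coneSnd χ)
  let θ : T →ₗ[Aᵐᵒᵖ] S := lin (M := shift 1 T) ρ
  let φ₁ : S →ₗ[Aᵐᵒᵖ] X := (LinearMap.fst Aᵐᵒᵖ X T).comp (lin φ)
  let φ₂ : S →ₗ[Aᵐᵒᵖ] T := (LinearMap.snd Aᵐᵒᵖ X T).comp (lin φ)
  have hφ : ∀ s, lin φ s = ((φ₁ s, φ₂ s) : X × T) := fun s => rfl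
  have hθ₁ : ∀ s, θ (φ₂ s) = s := fun s =>
    congrArg (fun f => lin f s) (IsIso.hom_inv_id (φ ≫ coneSnd χ))
  have hθ₂ : ∀ t, φ₂ (θ t) = t := fun t =>
    congrArg (fun f : shift 1 T ⟶ shift 1 T => lin f t) (IsIso.inv_hom_id (φ ≫ coneSnd χ))
  have hθd : ∀ t, S.d (θ t) = -θ (T.d t) := fun t => by
    have := lin_d ρ t
    refine this.symm.trans ?_
    change θ ((((1 : ℤ).negOnePow : ℤˣ) : ℤ) • T.d t) = _
    simp
  have hθgr : ∀ i, ∀ t ∈ T.gr (i + 1), θ t ∈ S.gr i := fun i t ht =>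
    lin_mem ρ (i := i) (m := t) ht
  have hφd : ∀ s, φ₁ (S.d s) = X.d (φ₁ s) + lin χ (φ₂ s) := fun s =>
    congrArg (Prod.fst : X × T → X) (lin_d φ s)
  -- As `φ (θ t) = (φ₁ (θ t), t)`, an element `(x, t)` is congruent to `(x - φ₁ (θ t), 0)` modulo
  -- the image of `φ`. The map `r` records this representative, and `H` below sends `t` to `-θ t` to
  -- undo the cancelled pair.
  let r : cone φ ⟶ X := homMk (M := cone φ)
    ((LinearMap.fst Aᵐᵒᵖ X T - (φ₁.comp θ).comp (LinearMap.snd Aᵐᵒᵖ X T)).comp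
      (LinearMap.fst Aᵐᵒᵖ (X × T) S))
    (fun i m hm => sub_mem hm.1.1 (lin_mem φ (hθgr _ _ hm.1.2)).1)
    (by
      rintro ⟨⟨x, t⟩, s⟩
      change X.d x + lin χ t + φ₁ s - φ₁ (θ (-T.d t + φ₂ s)) = X.d (x - φ₁ (θ t))
      have := hφd (θ t)
      rw [hθd, hθ₂, map_neg] at this
      rw [map_add, hθ₁, map_neg, map_add, map_neg, map_sub, this]
      abel)
  let i : X ⟶ cone φ := coneInl χ ≫ coneInl φ
  have hir : i ≫ r = 𝟙 X := ext_apply fun x => by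
    change x - φ₁ (θ 0) = x
    rw [map_zero, map_zero, sub_zero]
  let H : cone φ →ₗ[Aᵐᵒᵖ] cone φ :=
    -(LinearMap.inr Aᵐᵒᵖ (X × T) S).comp
      (θ.comp ((LinearMap.snd Aᵐᵒᵖ X T).comp (LinearMap.fst Aᵐᵒᵖ (X × T) S)))
  have hri : Homotopic (r ≫ i) (𝟙 (cone φ)) := by
    refine ⟨H, fun j m hm => ?_, ?_⟩
    · refine ((cone φ).gr _).neg_mem ⟨zero_mem _, ?_⟩
      rw [sub_add_cancel]
      exact hθgr _ _ hm.1.2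
    · rintro ⟨⟨x, t⟩, s⟩
      change ((((x - φ₁ (θ t), 0), 0) - ((x, t), s) : (X × T) × S)) =
        (((cone χ).d (-((0, 0) : X × T)) + lin φ (-θ t), -S.d (-θ t)) : (X × T) × S) +
          (-((0, 0) : X × T), -θ (-T.d t + φ₂ s))
      have h0 : (cone χ).d (-((0, 0) : X × T)) = 0 := by
        have : -((0, 0) : X × T) = (0 : cone χ) := neg_zero
        rw [this, map_zero]
      rw [h0, zero_add, hφ]
      refine Prod.ext (Prod.ext ?_ ?_) ?_
      · change x - φ₁ (θ t) - x = φ₁ (-θ t) + -0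
        rw [map_neg]
        abel
      · change 0 - t = φ₂ (-θ t) + -0
        rw [map_neg, hθ₂]
        abel
      · change 0 - s = -S.d (-θ t) + -θ (-T.d t + φ₂ s)
        rw [map_neg, hθd, map_add, hθ₁, map_neg]
        abel
  exact ⟨⟨DGHot.quot.map r, DGHot.quot.map i,
    (DGHot.quot.map_comp r i).symm.trans
      ((CategoryTheory.Quotient.sound _ hri).trans (DGHot.quot.map_id _)),
    (DGHot.quot.map_comp i r).symm.trans ((congrArg _ hir).trans (DGHot.quot.map_id _))⟩⟩

/-- The shift of a mapping cone is a mapping cone. -/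
theorem exists_iso_shift_cone (n : ℤ) {X Y : DGModule 𝒜} (φ : X ⟶ Y) :
    ∃ ψ : shift n X ⟶ shift n Y, Nonempty (shift n (cone φ) ≅ cone ψ) := by
  -- The sign `(-1)^n` multiplies the whole differential of the cone, including its `φ` entry; with
  -- this `ψ` the identity map is an isomorphism.
  let ψ : shift n X ⟶ shift n Y := homMk (M := shift n X) (N := shift n Y)
    (((n.negOnePow : ℤˣ) : ℤ) • lin φ)
    (fun i x hx => (Y.gr _).zsmul_mem (lin_mem φ hx) _)
    (fun x => by
      have key : ∀ x : X, ((n.negOnePow : ℤˣ) : ℤ) • lin φ (((n.negOnePow : ℤˣ) : ℤ) • X.d x) =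
          ((n.negOnePow : ℤˣ) : ℤ) • Y.d (((n.negOnePow : ℤˣ) : ℤ) • lin φ x) := fun x => by
        rw [map_zsmul, map_zsmul, lin_d]
      exact key x)
  refine ⟨ψ, nonempty_iso_of_linearEquiv (M := shift n (cone φ)) (N := cone ψ)
    (LinearEquiv.refl Aᵐᵒᵖ (Y × X)) (fun i m hm => ⟨hm.1, ?_⟩) ?_⟩
  · have : m.2 ∈ X.gr (i + n + 1) := hm.2
    rwa [add_right_comm] at this
  · rintro ⟨y, x⟩
    change ((n.negOnePow : ℤˣ) : ℤ) • ((Y.d y + lin φ x, -X.d x) : Y × X) =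
      (((n.negOnePow : ℤˣ) : ℤ) • Y.d y + ((n.negOnePow : ℤˣ) : ℤ) • lin φ x,
        -(((n.negOnePow : ℤˣ) : ℤ) • X.d x))
    rw [Prod.smul_mk, smul_add, smul_neg]

end DGModule

/-! ### Extension of scalars, Schur's lemma and graded splittings -/

section Hat

open TensorProduct

variable {k : Type u} [CommRing k] {A : Type v} [Ring A] [Algebra k A] {𝒜 : DGAlgebra k A}

/-- The inclusion `A^0 → A`. -/
def DGAlgebra.degZeroHom (𝒜 : DGAlgebra k A) : 𝒜.degZero →+* A where
  toFun b := b
  map_one' := rfl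
  map_mul' _ _ := rfl
  map_zero' := rfl
  map_add' _ _ := rfl

/-- A dg module is a right module over `A^0`. -/
instance DGModule.degZeroModule (M : DGModule 𝒜) : Module 𝒜.degZeroᵐᵒᵖ M :=
  Module.compHom M (RingHom.op 𝒜.degZeroHom)

theorem DGModule.degZero_smul (M : DGModule 𝒜) (b : 𝒜.degZeroᵐᵒᵖ) (m : M) :
    b • m = MulOpposite.op (b.unop : A) • m := rfl

/-- An `A`-linear map of dg modules is `A^0`-linear. -/
def DGModule.degZeroLin {M N : DGModule 𝒜} (f : M →ₗ[Aᵐᵒᵖ] N) : M →ₗ[𝒜.degZeroᵐᵒᵖ] N where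
  toFun := f
  map_add' := map_add f
  map_smul' _ m := map_smul f _ m

/-- The projection to a homogeneous component is `A^0`-linear. -/
noncomputable def DGModule.degZeroProj (M : DGModule 𝒜) (i : ℤ) : M →ₗ[𝒜.degZeroᵐᵒᵖ] M where
  toFun := M.proj i
  map_add' := map_add _
  map_smul' b m := by
    refine (map_proj (DistribSMul.toAddMonoidHom M (MulOpposite.op (b.unop : A)))
      (fun i m hm => ?_) i m).symm
    have := M.smul_mem i 0 m hm _ b.unop.2
    rwa [add_zero] at this

namespace DGAlgebra

variable {L L' : Type v} [AddCommGroup L] [Module 𝒜.degZeroᵐᵒᵖ L] [AddCommGroup L']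
  [Module 𝒜.degZeroᵐᵒᵖ L'] (h : ∀ a ∈ 𝒜.gr 0, 𝒜.d a = 0)

/-- The element `l ⊗ a` of `L ⊗_{A^0} A`. -/
def hatMk (l : L) (a : A) : 𝒜.hat L h := (balancedRel 𝒜 L).mkQ (a ⊗ₜ[ℤ] l)

theorem hatMk_add_left (l l' : L) (a : A) :
    hatMk h (l + l') a = hatMk h l a + hatMk h l' a :=
  (congrArg _ (tmul_add a l l')).trans (map_add (balancedRel 𝒜 L).mkQ _ _)

theorem hatMk_op_smul (l : L) (b : 𝒜.degZeroᵐᵒᵖ) (a : A) :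
    hatMk h (b • l) a = hatMk h l (b.unop * a) := by
  refine (Submodule.Quotient.eq _).2 (Submodule.subset_span ⟨l, b.unop, a, ?_⟩)
  rw [MulOpposite.op_unop]

theorem smul_hatMk (l : L) (a : A) (b : Aᵐᵒᵖ) :
    b • hatMk h l a = hatMk h l (a * b.unop) := rfl

theorem hatMk_eq (l : L) (a : A) : hatMk h l a = MulOpposite.op a • hatMk h l 1 := by
  rw [smul_hatMk, MulOpposite.unop_op, one_mul]

theorem hatMk_mem (l : L) {a : A} {i : ℤ} (ha : a ∈ 𝒜.gr i) : hatMk h l a ∈ (𝒜.hat L h).gr i :=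
  AddSubgroup.subset_closure ⟨a, ha, l, rfl⟩

theorem one_mem_gr_zero : (1 : A) ∈ 𝒜.gr 0 := SetLike.one_mem_graded 𝒜.gr

theorem hat_induction {p : 𝒜.hat L h → Prop} (zero : p 0)
    (add : ∀ x y, p x → p y → p (x + y)) (mk : ∀ l a, p (hatMk h l a)) (x : 𝒜.hat L h) : p x := by
  obtain ⟨t, rfl⟩ := (balancedRel 𝒜 L).mkQ_surjective x
  induction t using TensorProduct.induction_on with
  | zero => exact (map_zero (balancedRel 𝒜 L).mkQ).symm ▸ zero
  | add x y hx hy => exact (map_add (balancedRel 𝒜 L).mkQ x y).symm ▸ add _ _ hx hy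
  | tmul a l => exact mk l a

theorem hat_linearMap_ext {M : DGModule 𝒜} {f g : 𝒜.hat L h →ₗ[Aᵐᵒᵖ] M}
    (hfg : ∀ l : L, f (hatMk h l 1) = g (hatMk h l 1)) : f = g := by
  ext x
  induction x using hat_induction with
  | zero => rw [map_zero, map_zero]
  | add x y hx hy => rw [map_add, map_add, hx, hy]
  | mk l a => rw [hatMk_eq, map_smul, map_smul, hfg]

theorem hat_gr_induction {i : ℤ} {p : 𝒜.hat L h → Prop} (zero : p 0)
    (add : ∀ x y, p x → p y → p (x + y)) (neg : ∀ x, p x → p (-x))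
    (mk : ∀ l, ∀ a ∈ 𝒜.gr i, p (hatMk h l a)) (x : 𝒜.hat L h) (hx : x ∈ (𝒜.hat L h).gr i) :
    p x := by
  induction hx using AddSubgroup.closure_induction with
  | mem x hx =>
    obtain ⟨a, ha, l, rfl⟩ := hx
    exact mk l a ha
  | zero => exact zero
  | add x y _ _ hx hy => exact add x y hx hy
  | neg x _ hx => exact neg x hx

/-- The `A^0`-linear map `L → L ⊗_{A^0} A`. -/
def hatι : L →ₗ[𝒜.degZeroᵐᵒᵖ] 𝒜.hat L h where
  toFun l := hatMk h l 1
  map_add' l l' := hatMk_add_left h l l' 1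
  map_smul' b l := by
    rw [hatMk_op_smul, RingHom.id_apply, DGModule.degZero_smul, smul_hatMk, mul_one, one_mul,
      MulOpposite.unop_op]

/-- The `A`-linear map `L ⊗_{A^0} A → M` induced by an `A^0`-linear map `L → M`. -/
def hatLift {M : DGModule 𝒜} (g : L →ₗ[𝒜.degZeroᵐᵒᵖ] M) : 𝒜.hat L h →ₗ[Aᵐᵒᵖ] M :=
  let G : A ⊗[ℤ] L →+ M := TensorProduct.liftAddHom
    { toFun := fun a => (DistribSMul.toAddMonoidHom M (MulOpposite.op a)).comp g.toAddMonoidHom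
      map_zero' := by ext l; simp
      map_add' := fun a b => by ext l; simp [add_smul] }
    (fun r a l => by
      change MulOpposite.op (r • a) • g l = MulOpposite.op a • g (r • l)
      rw [map_zsmul, MulOpposite.op_smul, smul_assoc, smul_comm])
  have hG : ∀ a l, G (a ⊗ₜ[ℤ] l) = MulOpposite.op a • g l := fun a l => rfl
  let G' : A ⊗[ℤ] L →ₗ[Aᵐᵒᵖ] M :=
    { toFun := G
      map_add' := map_add G
      map_smul' := fun b t => by
        induction t using TensorProduct.induction_on with
        | zero => simp
        | add x y hx hy => rw [smul_add, map_add, hx, hy, map_add, smul_add]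
        | tmul a l =>
          rw [TensorProduct.smul_tmul', hG, hG, RingHom.id_apply, smul_smul]
          rfl }
  have hG' : ∀ t, G' t = G t := fun _ => rfl
  (balancedRel 𝒜 L).liftQ G' (by
    refine Submodule.span_le.2 ?_
    rintro _ ⟨l, b, a, rfl⟩
    refine LinearMap.mem_ker.2 ?_
    rw [hG', map_sub, hG, hG, map_smul, DGModule.degZero_smul, smul_smul, MulOpposite.op_mul]
    exact sub_self _)

theorem hatLift_hatMk {M : DGModule 𝒜} (g : L →ₗ[𝒜.degZeroᵐᵒᵖ] M) (l : L) (a : A) :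
    hatLift h g (hatMk h l a) = MulOpposite.op a • g l := rfl

theorem hatLift_mem {M : DGModule 𝒜} (g : L →ₗ[𝒜.degZeroᵐᵒᵖ] M) {n : ℤ}
    (hg : ∀ l, g l ∈ M.gr n) {i : ℤ} {x : 𝒜.hat L h} (hx : x ∈ (𝒜.hat L h).gr i) :
    hatLift h g x ∈ M.gr (n + i) := by
  refine hat_gr_induction h (p := fun x => hatLift h g x ∈ M.gr (n + i)) ?_ (fun x y hx hy => ?_) (fun x hx => ?_)
    (fun l a ha => ?_) x hx
  · rw [map_zero]; exact zero_mem _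
  · rw [map_add]; exact add_mem hx hy
  · rw [map_neg]; exact neg_mem hx
  · exact M.smul_mem _ _ _ (hg l) _ ha

/-- In degree zero `l ⊗ a = l a ⊗ 1`. Surjectivity of `L` onto the degree zero part is all that
Schur's lemma below requires. -/
theorem mem_range_hatι {x : 𝒜.hat L h} (hx : x ∈ (𝒜.hat L h).gr 0) :
    x ∈ LinearMap.range (hatι h (L := L)) := by
  refine hat_gr_induction h (p := fun x => x ∈ LinearMap.range (hatι h (L := L))) ?_ (fun x y hx hy => ?_) (fun x hx => ?_)
    (fun l a ha => ?_) x hx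
  · exact zero_mem _
  · exact add_mem hx hy
  · exact neg_mem hx
  ·
    refine ⟨MulOpposite.op (⟨a, ha⟩ : 𝒜.degZero) • l, ?_⟩
    change hatMk h _ 1 = _
    rw [hatMk_op_smul, mul_one]
    rfl

theorem eq_zero_of_mem_hat_gr_neg (h𝒜 : 𝒜.IsPositiveSemisimple) {x : 𝒜.hat L h} {i : ℤ}
    (hi : i < 0) (hx : x ∈ (𝒜.hat L h).gr i) : x = 0 := by
  refine hat_gr_induction h (p := fun x => x = 0) ?_ (fun x y hx hy => ?_) (fun x hx => ?_)
    (fun l a ha => ?_) x hx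
  · rfl
  · rw [hx, hy, add_zero]
  · rw [hx, neg_zero]
  ·
    rw [h𝒜.gr_neg i hi, Submodule.mem_bot] at ha
    rw [ha, hatMk_eq, MulOpposite.op_zero, zero_smul]

/-- Every module over `A^0` is projective. -/
theorem IsPositiveSemisimple.projective (h𝒜 : 𝒜.IsPositiveSemisimple) (L : Type v)
    [AddCommGroup L] [Module 𝒜.degZeroᵐᵒᵖ L] : Module.Projective 𝒜.degZeroᵐᵒᵖ L :=
  have := h𝒜.semisimple
  Module.projective_of_isSemisimpleRing _ _

/-- A version of Schur's lemma: for simple `L` and `L'` and `q ≤ p`, a morphism of dg modules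
from `{p}(L ⊗_{A^0} A)` to `{q}(L' ⊗_{A^0} A)` is zero or an isomorphism. -/
theorem eq_zero_or_isIso (h𝒜 : 𝒜.IsPositiveSemisimple) (hL : IsSimpleModule 𝒜.degZeroᵐᵒᵖ L)
    (hL' : IsSimpleModule 𝒜.degZeroᵐᵒᵖ L') {p q : ℤ} (hpq : q ≤ p)
    (ψ : DGModule.shift p (𝒜.hat L h) ⟶ DGModule.shift q (𝒜.hat L' h)) :
    (∀ x, DGModule.lin ψ x = 0) ∨ IsIso ψ := by
  let f : 𝒜.hat L h →ₗ[Aᵐᵒᵖ] 𝒜.hat L' h :=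
    DGModule.lin (M := DGModule.shift p (𝒜.hat L h)) (N := DGModule.shift q (𝒜.hat L' h)) ψ
  -- The generators `l ⊗ 1` have degree `-p` in `{p}L̂`, so their images lie in degree `q - p ≤ 0`
  -- of `L̂'`.
  have hf : ∀ l, f (hatMk h l 1) ∈ (𝒜.hat L' h).gr (-p + q) := fun l => by
    refine DGModule.lin_mem ψ (i := -p) ?_
    change hatMk h l 1 ∈ (𝒜.hat L h).gr (-p + p)
    rw [neg_add_cancel]
    exact hatMk_mem h l one_mem_gr_zero
  have of_zero : (∀ l, f (hatMk h l 1) = 0) → ∀ x, f x = 0 := fun h0 x => by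
    rw [hat_linearMap_ext h (f := f) (g := 0) h0, LinearMap.zero_apply]
  rcases hpq.lt_or_eq with hlt | rfl
  · exact Or.inl (of_zero fun l => eq_zero_of_mem_hat_gr_neg h h𝒜 (by omega) (hf l))
  · simp only [neg_add_cancel] at hf
    have := h𝒜.projective L
    -- Projectivity of `L` turns the degree zero part of `f` into a map `L → L'` without injectivity
    -- of `hatι`.
    obtain ⟨g, hg⟩ := Module.projective_lifting_property (hatι h (L := L')).rangeRestrict
      (((DGModule.degZeroLin f).comp (hatι h)).codRestrict _ fun l => mem_range_hatι h (hf l))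
      (LinearMap.surjective_rangeRestrict _)
    have hg' : ∀ l, hatMk h (g l) 1 = f (hatMk h l 1) := fun l =>
      congrArg Subtype.val (LinearMap.congr_fun hg l)
    rcases LinearMap.bijective_or_eq_zero g with hbij | h0
    · right
      let e := LinearEquiv.ofBijective g hbij
      have he : ∀ l, g (e.symm l) = l := e.apply_symm_apply
      have he' : ∀ l, e.symm (g l) = l := e.symm_apply_apply
      let f' : 𝒜.hat L' h →ₗ[Aᵐᵒᵖ] 𝒜.hat L h := hatLift h ((hatι h).comp e.symm.toLinearMap)
      have hf' : ∀ l, f' (hatMk h l 1) = hatMk h (e.symm l) 1 := fun l =>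
        (hatLift_hatMk h _ l 1).trans (one_smul _ _)
      refine DGModule.isIso_of_bijective ψ
        (Function.bijective_iff_has_inverse.2 ⟨f', fun x => ?_, fun x => ?_⟩)
      · refine LinearMap.congr_fun (f := f'.comp f) (g := LinearMap.id)
          (hat_linearMap_ext h fun l => ?_) x
        rw [LinearMap.comp_apply, ← hg', hf', he', LinearMap.id_apply]
      · refine LinearMap.congr_fun (f := f.comp f') (g := LinearMap.id)
          (hat_linearMap_ext h fun l => ?_) x
        rw [LinearMap.comp_apply, hf', ← hg', he, LinearMap.id_apply]
    · refine Or.inl (of_zero fun l => ?_)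
      rw [← hg', h0]
      exact map_zero (hatι h)

end DGAlgebra

namespace DGModule

theorem mem_gr_of_lin_mem {M N : DGModule 𝒜} (f : M ⟶ N) (hf : Function.Injective (lin f))
    {i : ℤ} {m : M} (hm : lin f m ∈ N.gr i) : m ∈ M.gr i := by
  have : m = M.proj i m := hf (by rw [lin_proj, N.proj_of_mem hm])
  rw [this]
  exact M.proj_mem _ _

/-- A short exact sequence of dg modules that splits as a sequence of graded modules comes from
a mapping cone. -/
theorem exists_iso_cone_of_section {N M Q : DGModule 𝒜} (f : N ⟶ M) (p : M ⟶ Q)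
    (hf : Function.Injective (lin f)) (hfp : ∀ m, lin p m = 0 ↔ ∃ n, lin f n = m)
    (σ : Q →ₗ[Aᵐᵒᵖ] M) (hσgr : ∀ i, ∀ t ∈ Q.gr i, σ t ∈ M.gr i) (hσ : ∀ t, lin p (σ t) = t) :
    ∃ χ : shift (-1) Q ⟶ N, Nonempty (M ≅ cone χ) := by
  -- The failure of `σ` to commute with the differentials. It is `A`-linear because `σ` preserves
  -- degrees, so that the two signed Leibniz terms cancel.
  let δ : Q →ₗ[Aᵐᵒᵖ] M :=
    { toFun := fun t => M.d (σ t) - σ (Q.d t)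
      map_add' := fun x y => by simp only [map_add]; abel
      map_smul' := fun a t => by
        induction t using Q.gr_induction with
        | zero => simp
        | add x y hx hy =>
          simp only [smul_add, map_add, RingHom.id_apply, smul_sub] at hx hy ⊢
          rw [add_sub_add_comm, hx, hy]
          abel
        | mem i t ht =>
          have h1 := Q.leibniz i t ht a.unop
          have h2 := M.leibniz i (σ t) (hσgr i t ht) a.unop
          rw [MulOpposite.op_unop] at h1 h2
          rw [map_smul, h1, h2, map_add, map_zsmul, map_smul, map_smul, RingHom.id_apply, smul_sub]
          abel }
  have hδ : ∀ t, δ t = M.d (σ t) - σ (Q.d t) := fun _ => rfl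
  have hδr : ∀ t, δ t ∈ LinearMap.range (lin f) := fun t => by
    refine (hfp _).1 ?_
    rw [hδ, map_sub, hσ, lin_d, hσ, sub_self]
  let e := LinearEquiv.ofInjective (lin f) hf
  let χ₀ : Q →ₗ[Aᵐᵒᵖ] N := e.symm.toLinearMap.comp (δ.codRestrict _ hδr)
  have hχ₀ : ∀ t, lin f (χ₀ t) = M.d (σ t) - σ (Q.d t) := fun t =>
    congrArg Subtype.val (e.apply_symm_apply ⟨δ t, hδr t⟩)
  have hχd : ∀ t, N.d (χ₀ t) = -χ₀ (Q.d t) := fun t => hf (by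
    rw [lin_d, map_neg, hχ₀, hχ₀, map_sub, M.d_d, Q.d_d, map_zero, sub_zero, zero_sub])
  have hχgr : ∀ i, ∀ t ∈ Q.gr i, χ₀ t ∈ N.gr (i + 1) := fun i t ht => by
    refine mem_gr_of_lin_mem f hf ?_
    rw [hχ₀]
    exact sub_mem (M.d_mem _ _ (hσgr _ _ ht)) (hσgr _ _ (Q.d_mem _ _ ht))
  -- `χ₀` raises degrees by one and anticommutes with the differentials; shifting the source by `-1`
  -- corrects both.
  let χ : shift (-1) Q ⟶ N := homMk (M := shift (-1) Q) χ₀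
    (fun i t ht => by
      have := hχgr _ _ ht
      rwa [neg_add_cancel_right] at this)
    (fun t => by
      refine Eq.trans ?_ (hχd t).symm
      change χ₀ ((((-1 : ℤ).negOnePow : ℤˣ) : ℤ) • Q.d t) = _
      rw [map_zsmul]
      simp)
  let G : cone χ ⟶ M := homMk (M := cone χ)
    (LinearMap.coprod (lin f) σ : N × Q →ₗ[Aᵐᵒᵖ] M)
    (fun i m hm => add_mem (lin_mem f hm.1) (hσgr _ _ (by
      have : m.2 ∈ Q.gr (i + 1 + -1) := hm.2
      rwa [add_neg_cancel_right] at this)))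
    (by
      rintro ⟨n, t⟩
      have key : ∀ t : Q, lin f (N.d n + χ₀ t) + σ (-((((-1 : ℤ).negOnePow : ℤˣ) : ℤ) • Q.d t)) =
          M.d (lin f n + σ t) := fun t => by
        rw [map_add, map_add, hχ₀, lin_d, Int.negOnePow_neg, Int.negOnePow_one, Units.val_neg,
          Units.val_one, neg_one_smul, neg_neg, add_assoc, sub_add_cancel]
      exact key t)
  have hG : ∀ (n : N) (t : Q), lin G ((n, t) : N × Q) = lin f n + σ t := fun _ _ => rfl
  have := isIso_of_bijective G (by
    constructor
    · refine (injective_iff_map_eq_zero (lin G)).2 ?_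
      rintro ⟨n, t⟩ h0
      have key : ∀ t : Q, lin f n + σ t = 0 → n = 0 ∧ t = 0 := fun t ht => by
        have ht' := congrArg (lin p) ht
        rw [map_add, hσ, (hfp _).2 ⟨n, rfl⟩, zero_add, map_zero] at ht'
        rw [ht', map_zero, add_zero] at ht
        exact ⟨hf (ht.trans (map_zero _).symm), ht'⟩
      exact Prod.ext (key t h0).1 (key t h0).2
    · intro m
      obtain ⟨n, hn⟩ := (hfp (m - σ (lin p m))).1 (by rw [map_sub, hσ, sub_self])
      refine ⟨((n, lin p m) : N × Q), (hG _ _).trans ?_⟩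
      rw [hn, sub_add_cancel])
  exact ⟨χ, ⟨(asIso G).symm⟩⟩

/-- A short exact sequence of dg modules with quotient `{l}(L ⊗_{A^0} A)` comes from a mapping
cone. -/
theorem exists_iso_cone_of_hat (h𝒜 : 𝒜.IsPositiveSemisimple) {L : Type v} [AddCommGroup L]
    [Module 𝒜.degZeroᵐᵒᵖ L] {N M Q : DGModule 𝒜} (f : N ⟶ M) (p : M ⟶ Q)
    (hf : Function.Injective (lin f)) (hp : Function.Surjective (lin p))
    (hfp : ∀ m, lin p m = 0 ↔ ∃ n, lin f n = m) (n : ℤ)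
    (e : Q ≅ shift n (𝒜.hat L h𝒜.d_degZero)) :
    ∃ χ : shift (-1) Q ⟶ N, Nonempty (M ≅ cone χ) := by
  have := h𝒜.projective L
  let h := h𝒜.d_degZero
  let e₁ : Q →ₗ[Aᵐᵒᵖ] 𝒜.hat L h := lin (N := shift n (𝒜.hat L h)) e.hom
  let e₂ : 𝒜.hat L h →ₗ[Aᵐᵒᵖ] Q := lin (M := shift n (𝒜.hat L h)) e.inv
  have he : ∀ t, e₂ (e₁ t) = t := fun t =>
    congrArg (fun f => lin f t) e.hom_inv_id
  obtain ⟨g, hg⟩ := Module.projective_lifting_property (degZeroLin (lin p))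
    ((degZeroLin e₂).comp (DGAlgebra.hatι h)) hp
  have hg' : ∀ l, lin p (g l) = e₂ (DGAlgebra.hatMk h l 1) := LinearMap.congr_fun hg
  -- The lift `g` given by projectivity need not be homogeneous. It is cut down to degree `-n`,
  -- where `l ⊗ 1` lives in `{n}L̂`. The section need not respect the differentials.
  let σ₀ : 𝒜.hat L h →ₗ[Aᵐᵒᵖ] M := DGAlgebra.hatLift h ((M.degZeroProj (-n)).comp g)
  have hσ₀ : ∀ x, lin p (σ₀ x) = e₂ x := fun x => by
    refine LinearMap.congr_fun (f := (lin p).comp σ₀) (g := e₂)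
      (DGAlgebra.hat_linearMap_ext h fun l => ?_) x
    have h1 : σ₀ (DGAlgebra.hatMk h l 1) = M.proj (-n) (g l) :=
      (DGAlgebra.hatLift_hatMk h _ l 1).trans (one_smul _ _)
    rw [LinearMap.comp_apply, h1, lin_proj, hg']
    refine Q.proj_of_mem (lin_mem e.inv ?_)
    change DGAlgebra.hatMk h l 1 ∈ (𝒜.hat L h).gr (-n + n)
    rw [neg_add_cancel]
    exact DGAlgebra.hatMk_mem h l DGAlgebra.one_mem_gr_zero
  refine exists_iso_cone_of_section f p hf hfp (σ₀.comp e₁) (fun i t ht => ?_) (fun t => ?_)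
  · have h1 : e₁ t ∈ (𝒜.hat L h).gr (i + n) := lin_mem e.hom ht
    have := DGAlgebra.hatLift_mem h ((M.degZeroProj (-n)).comp g)
      (fun l => M.proj_mem (-n) (g l)) h1
    rwa [neg_add_cancel_comm_assoc] at this
  · rw [LinearMap.comp_apply, hσ₀, he]

end DGModule

end Hat

/-! ### Dg submodules and their subquotients -/

namespace DGSubmodule

variable {k : Type u} [CommRing k] {A : Type v} [Ring A] [Algebra k A] {𝒜 : DGAlgebra k A}
  {M : DGModule 𝒜}

/-- A dg submodule, regarded as a dg module. -/
noncomputable def toDGModule (P : DGSubmodule M) : DGModule 𝒜 where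
  carrier := P.sub
  gr i := (M.gr i).comap P.sub.subtype.toAddMonoidHom
  isInternal := by
    refine isInternal_of_proj (fun i => ((M.proj i).comp P.sub.subtype.toAddMonoidHom).codRestrict
      P.sub (fun x => P.proj_mem i _ x.2)) ?_ ?_ ?_
    · exact fun i x hx => Subtype.ext (M.proj_of_mem hx)
    · exact fun i j hij x hx => Subtype.ext (M.proj_of_mem_ne hij hx)
    · intro x
      classical
      obtain ⟨v, hv⟩ := M.isInternal.2 x
      have hc : ∀ i, (v i : M) ∈ P.sub := fun i => by
        rw [← gradedProj_coe M.isInternal i v, hv]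
        exact P.proj_mem i _ x.2
      have hs : x = ∑ i ∈ DFinsupp.support v, (⟨v i, hc i⟩ : P.sub) := by
        refine Subtype.ext ?_
        rw [← hv, DirectSum.coeAddMonoidHom_eq_dfinsuppSum, DFinsupp.sum]
        simp
      rw [hs]
      exact sum_mem fun i _ => AddSubgroup.mem_iSup_of_mem i (v i).2
  smul_mem i j m hm a ha := M.smul_mem i j _ hm a ha
  d := (M.d.comp P.sub.subtype.toAddMonoidHom).codRestrict P.sub (fun x => P.d_mem _ x.2)
  d_mem i m hm := M.d_mem i _ hm
  d_d m := Subtype.ext (M.d_d m)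
  leibniz i m hm a := Subtype.ext (M.leibniz i _ hm a)

/-- The first isomorphism theorem, used to identify the steps of a filtration. -/
theorem nonempty_iso_subquotient {Q : DGModule 𝒜} (N P : DGSubmodule M) (g : P.sub →ₗ[Aᵐᵒᵖ] Q)
    (hg : Function.Surjective g) (hker : ∀ x : P.sub, g x = 0 ↔ (x : M) ∈ N.sub)
    (hgr : ∀ i, ∀ x : P.sub, (x : M) ∈ M.gr i → g x ∈ Q.gr i)
    (hd : ∀ x : P.sub, g ⟨M.d x, P.d_mem _ x.2⟩ = Q.d (g x)) :
    Nonempty (subquotient N P ≅ Q) := by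
  have hle : N.sub.submoduleOf P.sub = LinearMap.ker g := by
    ext x
    exact (hker x).symm
  let G : subquotient N P ⟶ Q := DGModule.homMk (M := subquotient N P)
    ((N.sub.submoduleOf P.sub).liftQ g hle.le)
    (by
      rintro i _ ⟨x, hx, rfl⟩
      exact hgr i x hx)
    (by
      intro m
      obtain ⟨x, rfl⟩ := (N.sub.submoduleOf P.sub).mkQ_surjective m
      exact hd x)
  have := DGModule.isIso_of_bijective G (by
    constructor
    · refine (injective_iff_map_eq_zero (DGModule.lin G)).2 fun m hm => ?_
      obtain ⟨x, rfl⟩ := (N.sub.submoduleOf P.sub).mkQ_surjective m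
      exact (Submodule.Quotient.mk_eq_zero _).2 ((hker x).1 hm)
    · intro q
      obtain ⟨x, rfl⟩ := hg q
      exact ⟨(N.sub.submoduleOf P.sub).mkQ x, rfl⟩)
  exact ⟨asIso G⟩

/-- The image of a dg submodule. -/
def map {M' : DGModule 𝒜} (f : M ⟶ M') (P : DGSubmodule M) : DGSubmodule M' where
  sub := P.sub.map (DGModule.lin f)
  proj_mem := by
    rintro i _ ⟨x, hx, rfl⟩
    exact ⟨M.proj i x, P.proj_mem i x hx, DGModule.lin_proj f i x⟩
  d_mem := by
    rintro _ ⟨x, hx, rfl⟩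
    exact ⟨M.d x, P.d_mem x hx, DGModule.lin_d f x⟩

/-- The improper dg submodule. -/
def top (M : DGModule 𝒜) : DGSubmodule M where
  sub := ⊤
  proj_mem _ _ _ := trivial
  d_mem _ _ := trivial

theorem nonempty_iso_subquotient_map {M' : DGModule 𝒜} (f : M ⟶ M')
    (hf : Function.Injective (DGModule.lin f)) (N P : DGSubmodule M) :
    Nonempty (subquotient N P ≅ subquotient (N.map f) (P.map f)) := by
  let r : P.sub →ₗ[Aᵐᵒᵖ] (P.map f).sub :=
    ((DGModule.lin f).comp P.sub.subtype).codRestrict _ fun x => ⟨x, x.2, rfl⟩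
  refine nonempty_iso_subquotient (Q := subquotient (N.map f) (P.map f)) N P
    (((N.map f).sub.submoduleOf (P.map f).sub).mkQ.comp r) ?_ (fun x => ?_)
    (fun i x hx => ⟨r x, DGModule.lin_mem f hx, rfl⟩) (fun x => ?_)
  · intro q
    obtain ⟨⟨_, x, hx, rfl⟩, rfl⟩ := ((N.map f).sub.submoduleOf (P.map f).sub).mkQ_surjective q
    exact ⟨⟨x, hx⟩, rfl⟩
  · refine (Submodule.Quotient.mk_eq_zero _).trans ⟨?_, fun hx => ⟨x, hx, rfl⟩⟩
    rintro ⟨y, hy, hxy⟩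
    have hyx : y = (x : M) := hf hxy
    rwa [← hyx]
  · exact congrArg ((N.map f).sub.submoduleOf (P.map f).sub).mkQ
      (Subtype.ext (DGModule.lin_d f (x : M)))

theorem exists_ses (N P : DGSubmodule M) (hNP : N.sub ≤ P.sub) :
    ∃ (f : N.toDGModule ⟶ P.toDGModule) (p : P.toDGModule ⟶ subquotient N P),
      Function.Injective (DGModule.lin f) ∧ Function.Surjective (DGModule.lin p) ∧
        ∀ m, DGModule.lin p m = 0 ↔ ∃ n, DGModule.lin f n = m := by
  refine ⟨DGModule.homMk (M := N.toDGModule) (N := P.toDGModule) (Submodule.inclusion hNP)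
      (fun _ _ hm => hm) (fun _ => rfl),
    DGModule.homMk (M := P.toDGModule) (N := subquotient N P) (N.sub.submoduleOf P.sub).mkQ
      (fun i m hm => ⟨m, hm, rfl⟩) (fun _ => rfl), Submodule.inclusion_injective hNP,
    (N.sub.submoduleOf P.sub).mkQ_surjective, fun m => ?_⟩
  refine (Submodule.Quotient.mk_eq_zero _).trans ⟨fun hm => ⟨⟨m.1, hm⟩, rfl⟩, ?_⟩
  rintro ⟨n, rfl⟩
  exact n.2

theorem nonempty_iso_toDGModule (P : DGSubmodule M) (hP : P.sub = ⊤) :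
    Nonempty (P.toDGModule ≅ M) :=
  DGModule.nonempty_iso_of_linearEquiv (M := P.toDGModule) (LinearEquiv.ofTop P.sub hP)
    (fun _ _ hm => hm) (fun _ => rfl)

end DGSubmodule

/-! ### Cellular modules and the reordering of cells -/

section Cellular

variable {k : Type u} [CommRing k] {A : Type v} [Ring A] [Algebra k A] {𝒜 : DGAlgebra k A}
  (h𝒜 : 𝒜.IsPositiveSemisimple) {W : Type*} (L : W → Type v)
  [∀ x, AddCommGroup (L x)] [∀ x, Module 𝒜.degZeroᵐᵒᵖ (L x)]

open DGModule

/-- `T` is isomorphic to some `{n} L̂_x`. -/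
def IsShiftedHat (n : ℤ) (T : DGModule 𝒜) : Prop :=
  ∃ x, Nonempty (T ≅ shift n (𝒜.hat (L x) h𝒜.d_degZero))

/-- `M` is obtained from zero by successively attaching cells, i.e. by taking mapping cones of
morphisms from `{l - 1} L̂_x`, where the numbers `l` are decreasing and bounded below by `c`. -/
inductive IsCellular : ℤ → DGModule 𝒜 → Prop
  | of_subsingleton (c : ℤ) (M : DGModule 𝒜) (hM : Subsingleton M) : IsCellular c M
  | of_cone {c l : ℤ} {T N M : DGModule 𝒜} (hcl : c ≤ l) (hT : IsShiftedHat h𝒜 L (l - 1) T)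
      (hN : IsCellular l N) (χ : T ⟶ N) (e : M ≅ cone χ) : IsCellular c M

variable {h𝒜 L}

theorem IsShiftedHat.of_iso {n : ℤ} {T T' : DGModule 𝒜} (hT : IsShiftedHat h𝒜 L n T)
    (e : T' ≅ T) : IsShiftedHat h𝒜 L n T' := by
  obtain ⟨x, ⟨e'⟩⟩ := hT
  exact ⟨x, ⟨e ≪≫ e'⟩⟩

theorem IsShiftedHat.shift {n : ℤ} {T : DGModule 𝒜} (hT : IsShiftedHat h𝒜 L n T) (m p : ℤ)
    (h : m + n = p) : IsShiftedHat h𝒜 L p (DGModule.shift m T) := by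
  obtain ⟨x, ⟨e⟩⟩ := hT
  obtain ⟨e'⟩ := shift_shift m n p h (𝒜.hat (L x) h𝒜.d_degZero)
  exact ⟨x, ⟨(DGModule.shiftFunctor m).mapIso e ≪≫ e'⟩⟩

theorem IsShiftedHat.eq_zero_or_isIso (hL : ∀ x, IsSimpleModule 𝒜.degZeroᵐᵒᵖ (L x)) {p q : ℤ}
    (hqp : q ≤ p) {S T : DGModule 𝒜} (hS : IsShiftedHat h𝒜 L p S) (hT : IsShiftedHat h𝒜 L q T)
    (ψ : S ⟶ T) : (∀ s, lin ψ s = 0) ∨ IsIso ψ := by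
  obtain ⟨x, ⟨e⟩⟩ := hS
  obtain ⟨y, ⟨e'⟩⟩ := hT
  have hψ : ψ = e.hom ≫ (e.inv ≫ ψ ≫ e'.hom) ≫ e'.inv := by simp
  rcases DGAlgebra.eq_zero_or_isIso h𝒜.d_degZero h𝒜 (hL x) (hL y) hqp (e.inv ≫ ψ ≫ e'.hom)
    with h0 | h1
  · left
    intro s
    rw [hψ, lin_comp, lin_comp, h0, map_zero]
  · right
    rw [hψ]
    infer_instance

theorem IsCellular.mono {c c' : ℤ} (hc : c' ≤ c) {M : DGModule 𝒜} (hM : IsCellular h𝒜 L c M) :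
    IsCellular h𝒜 L c' M := by
  cases hM with
  | of_subsingleton _ _ hM => exact .of_subsingleton _ _ hM
  | of_cone hcl hT hN χ e => exact .of_cone (hc.trans hcl) hT hN χ e

theorem IsCellular.of_iso {c : ℤ} {M M' : DGModule 𝒜} (hM : IsCellular h𝒜 L c M) (e : M' ≅ M) :
    IsCellular h𝒜 L c M' := by
  cases hM with
  | of_subsingleton _ _ hM =>
    exact .of_subsingleton _ _ ((lin_bijective e).1.subsingleton)
  | of_cone hcl hT hN χ e' => exact .of_cone hcl hT hN χ (e ≪≫ e')

theorem IsCellular.shift {c : ℤ} {M : DGModule 𝒜} (hM : IsCellular h𝒜 L c M) (n : ℤ) :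
    IsCellular h𝒜 L (n + c) (DGModule.shift n M) := by
  induction hM with
  | of_subsingleton c M hM => exact .of_subsingleton _ _ hM
  | of_cone hcl hT hN χ e ih =>
    obtain ⟨ψ, ⟨e'⟩⟩ := exists_iso_shift_cone n χ
    exact .of_cone (by omega) (hT.shift n _ (by omega)) ih ψ
      ((DGModule.shiftFunctor n).mapIso e ≪≫ e')

variable (h𝒜 L) in
/-- `M` is homotopy equivalent to a cellular dg module. -/
def IsHomotopyCellular (c : ℤ) (M : DGModule 𝒜) : Prop :=
  ∃ M', IsCellular h𝒜 L c M' ∧ Nonempty (DGHot.quot.obj M ≅ DGHot.quot.obj M')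

theorem IsCellular.isHomotopyCellular {c : ℤ} {M : DGModule 𝒜} (hM : IsCellular h𝒜 L c M) :
    IsHomotopyCellular h𝒜 L c M :=
  ⟨M, hM, ⟨Iso.refl _⟩⟩

theorem IsHomotopyCellular.of_quot_iso {c : ℤ} {M M' : DGModule 𝒜}
    (hM : IsHomotopyCellular h𝒜 L c M) (e : DGHot.quot.obj M' ≅ DGHot.quot.obj M) :
    IsHomotopyCellular h𝒜 L c M' := by
  obtain ⟨N, hN, ⟨e'⟩⟩ := hM
  exact ⟨N, hN, ⟨e ≪≫ e'⟩⟩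

theorem IsHomotopyCellular.of_iso {c : ℤ} {M M' : DGModule 𝒜}
    (hM : IsHomotopyCellular h𝒜 L c M) (e : M' ≅ M) : IsHomotopyCellular h𝒜 L c M' :=
  hM.of_quot_iso (DGHot.quot.mapIso e)

/-- Attaching a cell to a cellular dg module, in any order, gives a cellular dg module up to
homotopy equivalence. -/
theorem IsCellular.isHomotopyCellular_cone (hL : ∀ x, IsSimpleModule 𝒜.degZeroᵐᵒᵖ (L x)) {c : ℤ}
    {N : DGModule 𝒜} (hN : IsCellular h𝒜 L c N) {l : ℤ} (hl : c ≤ l) {S : DGModule 𝒜}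
    (hS : IsShiftedHat h𝒜 L (l - 1) S) (φ : S ⟶ N) : IsHomotopyCellular h𝒜 L c (cone φ) := by
  induction hN with
  | of_subsingleton c N hN =>
    exact (IsCellular.of_cone hl hS (.of_subsingleton _ _ hN) φ (Iso.refl _)).isHomotopyCellular
  | @of_cone c l' T N₀ N hcl hT hN₀ χ e ih =>
    -- If `l ≤ l'`, the new cell already comes last in the decreasing order.
    rcases le_or_gt l l' with hll | hll
    · exact (IsCellular.of_cone hl hS (.of_cone hll hT hN₀ χ e) φ
        (Iso.refl _)).isHomotopyCellular
    obtain ⟨eφ⟩ := nonempty_iso_cone φ (φ ≫ e.hom) (Iso.refl _) e (by simp)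
    refine IsHomotopyCellular.of_iso ?_ eφ
    -- `{1}T` has shift `l'` and `S` has shift `l - 1`, so `l' < l` is exactly what Schur's lemma
    -- needs.
    rcases IsShiftedHat.eq_zero_or_isIso hL (show l' ≤ l - 1 by omega) hS
      (hT.shift 1 l' (by omega)) ((φ ≫ e.hom) ≫ coneSnd χ) with h0 | h1
    · obtain ⟨φ', hφ'⟩ := exists_eq_comp_coneInl (φ ≫ e.hom) h0
      rw [hφ']
      obtain ⟨es⟩ := nonempty_iso_cone_swap χ φ'
      refine IsHomotopyCellular.of_iso ?_ es
      -- `S` is attached to `N₀` first. The result still has lower bound `l'`, so `T` may go on top,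
      -- after transporting its attaching map along `eK`.
      obtain ⟨K, hK, ⟨eK⟩⟩ := ih hll.le φ'
      obtain ⟨χ', ⟨eχ⟩⟩ := exists_iso_quot_cone_right (χ ≫ coneInl φ') eK
      exact ⟨_, .of_cone hcl hT hK χ' (Iso.refl _), ⟨eχ⟩⟩
    -- Here `S` and `T` cancel, and `N₀` remains.
    · obtain ⟨ec⟩ := nonempty_iso_quot_cone_of_isIso χ (φ ≫ e.hom) h1
      exact (hN₀.mono hcl).isHomotopyCellular.of_quot_iso ec

/-- The mapping cone of a morphism between cellular dg modules is cellular up to homotopy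
equivalence. -/
theorem IsCellular.exists_isHomotopyCellular_cone
    (hL : ∀ x, IsSimpleModule 𝒜.degZeroᵐᵒᵖ (L x)) {c : ℤ} {X : DGModule 𝒜}
    (hX : IsCellular h𝒜 L c X) {c' : ℤ} {Y : DGModule 𝒜} (hY : IsCellular h𝒜 L c' Y)
    (φ : X ⟶ Y) : ∃ b, IsHomotopyCellular h𝒜 L b (cone φ) := by
  induction hX with
  | of_subsingleton c X hX =>
    obtain ⟨e⟩ := nonempty_iso_cone_of_subsingleton φ
    exact ⟨c', hY.isHomotopyCellular.of_iso e.symm⟩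
  | @of_cone c l T X₀ X hcl hT hX₀ χ e ih =>
    obtain ⟨eφ⟩ := nonempty_iso_cone φ (e.inv ≫ φ) e (Iso.refl _) (by simp)
    obtain ⟨ψ, ⟨eψ⟩⟩ := exists_iso_cone_cone χ (e.inv ≫ φ)
    obtain ⟨b, K, hK, ⟨eK⟩⟩ := ih (coneInl χ ≫ e.inv ≫ φ)
    obtain ⟨ψ', ⟨eψ'⟩⟩ := exists_iso_quot_cone_right ψ eK
    -- Shifting turns the cell of level `l` into one of level `l + 1`, hence the bound `min b (l +
    -- 1)`.
    have hT' := hT.shift 1 (l + 1 - 1) (by omega)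
    exact ⟨min b (l + 1), ((((hK.mono (min_le_left _ _)).isHomotopyCellular_cone hL
      (min_le_right _ _) hT' ψ').of_quot_iso eψ').of_iso eψ).of_iso eφ⟩

theorem HasHatFiltration.exists_isCellular {M : DGModule 𝒜} (hM : HasHatFiltration h𝒜 L M) :
    ∃ c, IsCellular h𝒜 L c M := by
  obtain ⟨n, F, l, x, h0, hlast, hl, hF⟩ := hM
  -- The bound `c` varies in the induction: the earlier stage is used with `c = l i`, which is a
  -- lower bound because `l` is antitone.
  have key : ∀ j : Fin (n + 1), ∀ c : ℤ, (∀ i : Fin n, i.castSucc < j → c ≤ l i) →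
      IsCellular h𝒜 L c (F j).toDGModule := by
    intro j
    induction j using Fin.induction with
    | zero =>
      intro c _
      refine .of_subsingleton _ _ (?_ : Subsingleton (F 0).sub)
      rw [h0]
      infer_instance
    | succ i ih =>
      intro c hc
      obtain ⟨hle, ⟨e⟩⟩ := hF i
      obtain ⟨f, p, hf, hp, hfp⟩ := DGSubmodule.exists_ses _ _ hle
      obtain ⟨χ, ⟨e'⟩⟩ := exists_iso_cone_of_hat h𝒜 f p hf hp hfp (l i) e
      have hQ : IsShiftedHat h𝒜 L (l i)
        (DGSubmodule.subquotient (F i.castSucc) (F i.succ)) := ⟨x i, ⟨e⟩⟩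
      exact .of_cone (hc i Fin.castSucc_lt_succ) (hQ.shift (-1) _ (by omega))
        (ih (l i) fun j hj => hl (Fin.castSucc_lt_castSucc_iff.1 hj).le) χ e'
  obtain ⟨e⟩ := (F (Fin.last n)).nonempty_iso_toDGModule hlast
  rcases Nat.eq_zero_or_pos n with rfl | hn
  · exact ⟨0, (key (Fin.last 0) 0 fun i => i.elim0).of_iso e.symm⟩
  · exact ⟨l ⟨n - 1, by omega⟩, (key _ _ fun i _ => hl (by
      rw [Fin.le_def]
      change (i : ℕ) ≤ n - 1
      omega)).of_iso e.symm⟩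

/-- The bound `c ≤ l i` is carried along so that appending the next, smaller integer keeps the
sequence antitone. The filtration of `N` is pushed forward along `N ⟶ cone χ ≅ M`, and `M` itself is
added at the end. -/
theorem IsCellular.exists_filtration {c : ℤ} {M : DGModule 𝒜} (hM : IsCellular h𝒜 L c M) :
    ∃ (n : ℕ) (F : Fin (n + 1) → DGSubmodule M) (l : Fin n → ℤ) (x : Fin n → W),
      ((F 0).sub = ⊥ ∧ (F (Fin.last n)).sub = ⊤ ∧ Antitone l ∧
        ∀ i : Fin n, (F i.castSucc).sub ≤ (F i.succ).sub ∧
          Nonempty (DGSubmodule.subquotient (F i.castSucc) (F i.succ) ≅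
            DGModule.shift (l i) (𝒜.hat (L (x i)) h𝒜.d_degZero))) ∧ ∀ i, c ≤ l i := by
  induction hM with
  | of_subsingleton c M hM =>
    refine ⟨0, fun _ => DGSubmodule.top M, Fin.elim0, Fin.elim0,
      ⟨?_, rfl, fun i => i.elim0, fun i => i.elim0⟩, fun i => i.elim0⟩
    exact Subsingleton.elim _ _
  | @of_cone c m T N M hcl hT hN χ e ih =>
    obtain ⟨n, F, l, x, ⟨h0, hlast, hl, hF⟩, hml⟩ := ih
    -- The new quotient is `{1}T`, which is why cells are attached along `{m - 1}L̂`.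
    obtain ⟨y, ⟨eT⟩⟩ := hT.shift 1 m (by omega)
    let f : N ⟶ M := coneInl χ ≫ e.inv
    have hf : Function.Injective (lin f) := by
      have h1 : Function.Injective (lin (coneInl χ)) := LinearMap.inl_injective
      exact (lin_bijective e.symm).1.comp h1
    let p : M ⟶ DGModule.shift 1 T := e.hom ≫ coneSnd χ
    have hp : Function.Surjective (lin p) := by
      have h1 : Function.Surjective (lin (coneSnd χ)) :=
        fun t => ⟨((0, t) : N × T), rfl⟩
      exact h1.comp (lin_bijective e).2
    have hpf : ∀ m, lin p m = 0 ↔ m ∈ LinearMap.range (lin f) := fun m => by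
      constructor
      · intro hm
        have hm' : (lin e.hom m : N × T).2 = 0 := hm
        refine ⟨(lin e.hom m : N × T).1, ?_⟩
        have h1 : lin (coneInl χ) (lin e.hom m : N × T).1 = lin e.hom m := Prod.ext rfl hm'.symm
        change lin e.inv (lin (coneInl χ) _) = m
        rw [h1, ← lin_comp, e.hom_inv_id, lin_id]
      · rintro ⟨n, rfl⟩
        change lin (coneSnd χ) (lin (e.inv ≫ e.hom) (lin (coneInl χ) n)) = 0
        rw [e.inv_hom_id]
        rfl
    let F' : Fin (n + 2) → DGSubmodule M :=
      Fin.snoc (α := fun _ => DGSubmodule M) (fun j => (F j).map f) (DGSubmodule.top M)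
    have hF'₁ : ∀ j : Fin (n + 1), F' j.castSucc = (F j).map f := fun j =>
      Fin.snoc_castSucc (α := fun _ => DGSubmodule M) _ _ j
    have hF'₂ : F' (Fin.last (n + 1)) = DGSubmodule.top M :=
      Fin.snoc_last (α := fun _ => DGSubmodule M) _ _
    have hFlast : ((F (Fin.last n)).map f).sub = LinearMap.range (lin f) := by
      change (F (Fin.last n)).sub.map (lin f) = _
      rw [hlast, Submodule.map_top]
    refine ⟨n + 1, F', Fin.snoc (α := fun _ => ℤ) l m, Fin.snoc (α := fun _ => W) x y,
      ⟨?_, ?_, ?_, ?_⟩, ?_⟩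
    · have := hF'₁ 0
      rw [Fin.castSucc_zero] at this
      rw [this]
      change (F 0).sub.map (lin f) = ⊥
      rw [h0, Submodule.map_bot]
    · rw [hF'₂]
      rfl
    · intro i j hij
      induction j using Fin.lastCases with
      | last =>
        rw [Fin.snoc_last]
        induction i using Fin.lastCases with
        | last => rw [Fin.snoc_last]
        | cast i => rw [Fin.snoc_castSucc]; exact hml i
      | cast j =>
        induction i using Fin.lastCases with
        | last => exact absurd hij (not_le.2 (Fin.castSucc_lt_last j))
        | cast i =>
          rw [Fin.snoc_castSucc, Fin.snoc_castSucc]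
          exact hl (Fin.castSucc_le_castSucc_iff.1 hij)
    · intro i
      induction i using Fin.lastCases with
      | last =>
        rw [Fin.succ_last, hF'₁, hF'₂, Fin.snoc_last, Fin.snoc_last]
        refine ⟨le_top, ?_⟩
        obtain ⟨e'⟩ := DGSubmodule.nonempty_iso_subquotient ((F (Fin.last n)).map f)
          (DGSubmodule.top M) ((lin p).comp (⊤ : Submodule Aᵐᵒᵖ M).subtype)
          (fun q => by
            obtain ⟨m, hm⟩ := hp q
            exact ⟨⟨m, trivial⟩, hm⟩)
          (fun m => by rw [hFlast]; exact hpf m) (fun i m hm => lin_mem p hm)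
          (fun m => lin_d p m)
        exact ⟨e' ≪≫ eT⟩
      | cast i =>
        rw [Fin.succ_castSucc, hF'₁, hF'₁, Fin.snoc_castSucc, Fin.snoc_castSucc]
        obtain ⟨hle, ⟨e₁⟩⟩ := hF i
        obtain ⟨e₂⟩ := DGSubmodule.nonempty_iso_subquotient_map f hf (F i.castSucc) (F i.succ)
        exact ⟨Submodule.map_mono hle, ⟨e₂.symm ≪≫ e₁⟩⟩
    · intro i
      induction i using Fin.lastCases with
      | last => rw [Fin.snoc_last]; exact hcl
      | cast i => rw [Fin.snoc_castSucc]; exact hcl.trans (hml i)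

theorem IsCellular.hasHatFiltration {c : ℤ} {M : DGModule 𝒜} (hM : IsCellular h𝒜 L c M) :
    HasHatFiltration h𝒜 L M := by
  obtain ⟨n, F, l, x, h, -⟩ := hM.exists_filtration
  exact ⟨n, F, l, x, h⟩

theorem IsCellular.prop_of_isStrictTriangulated {c : ℤ} {M : DGModule 𝒜}
    (hM : IsCellular h𝒜 L c M) {P : ObjectProperty (DGHot 𝒜)} (hP : DGHot.IsStrictTriangulated P)
    (hPL : ∀ x, P (DGHot.quot.obj (𝒜.hat (L x) h𝒜.d_degZero))) : P (DGHot.quot.obj M) := by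
  have := hP.iso
  have := hP.zero
  induction hM with
  | of_subsingleton c M hM => exact P.prop_of_isZero (isZero_quot_of_subsingleton M)
  | @of_cone c l T N M hcl hT hN χ e ih =>
    obtain ⟨x, ⟨eT⟩⟩ := hT
    have hPT : P (DGHot.quot.obj T) :=
      P.prop_of_iso (DGHot.quot.mapIso eT).symm (hP.shift (l - 1) _ (hPL x))
    refine P.prop_of_iso (DGHot.quot.mapIso e).symm ?_
    refine hP.third (DGHot.quot.map χ) (DGHot.quot.map (coneInl χ)) (DGHot.quot.map (coneSnd χ))
      ⟨T, N, χ, Iso.refl _, Iso.refl _, Iso.refl _, ?_, ?_, ?_⟩ hPT ih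
    · simp
    · simp
    · rw [Iso.refl_hom, CategoryTheory.Functor.map_id, Iso.refl_hom]
      exact (Category.comp_id _).trans (Category.id_comp _).symm

/-- A single cell attached to zero, obtained from the exact sequence `0 → 0 → L̂_x → L̂_x → 0`. -/
theorem isCellular_hat (x : W) : IsCellular h𝒜 L 0 (𝒜.hat (L x) h𝒜.d_degZero) := by
  let N := 𝒜.hat (L x) h𝒜.d_degZero
  obtain ⟨e⟩ := shift_zero_iso N
  obtain ⟨χ, ⟨eM⟩⟩ := exists_iso_cone_of_hat h𝒜 (zeroHom (zeroModule 𝒜) N) (𝟙 N)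
    (Function.injective_of_subsingleton _) Function.surjective_id
    (fun m => ⟨fun hm => ⟨0, hm.symm⟩, fun ⟨_, hn⟩ => hn.symm⟩) 0 e.symm
  have hN : IsShiftedHat h𝒜 L 0 N := ⟨x, ⟨e.symm⟩⟩
  exact .of_cone le_rfl (hN.shift (-1) _ (by omega)) (.of_subsingleton _ _ inferInstance) χ eM

/-- The dg modules that are homotopy equivalent to a cellular one form a strict full triangulated
subcategory. -/
theorem isStrictTriangulated_isHomotopyCellular
    (hL : ∀ x, IsSimpleModule 𝒜.degZeroᵐᵒᵖ (L x)) :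
    DGHot.IsStrictTriangulated
      (fun X : DGHot 𝒜 => ∃ c, IsHomotopyCellular h𝒜 L c X.as) where
  zero := by
    exact ⟨DGHot.quot.obj (zeroModule 𝒜), isZero_quot_of_subsingleton _, 0,
      (IsCellular.of_subsingleton 0 (zeroModule 𝒜) inferInstance).isHomotopyCellular⟩
  iso := ⟨fun e ⟨c, hc⟩ => ⟨c, hc.of_quot_iso e.symm⟩⟩
  shift n X := by
    rintro ⟨c, M, hM, ⟨e⟩⟩
    exact ⟨n + c, _, hM.shift n, ⟨(DGHot.shiftFunctor n).mapIso e⟩⟩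
  third {X Y Z} f g h := by
    rintro ⟨X', Y', φ, a, b, c, -, -, -⟩ ⟨_, MX, hMX, ⟨eX⟩⟩ ⟨_, MY, hMY, ⟨eY⟩⟩
    let eX' : DGHot.quot.obj X' ≅ DGHot.quot.obj MX := a.symm ≪≫ eX
    let eY' : DGHot.quot.obj Y' ≅ DGHot.quot.obj MY := b.symm ≪≫ eY
    -- A representative of `φ` between cellular models; its cone is homotopy equivalent to `cone φ`,
    -- hence to the third vertex.
    obtain ⟨φ', hφ'⟩ := DGHot.quot.map_surjective (eX'.inv ≫ DGHot.quot.map φ ≫ eY'.hom)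
    obtain ⟨e⟩ := nonempty_iso_quot_cone φ φ' eX' eY' (by rw [hφ', Iso.hom_inv_id_assoc])
    obtain ⟨d, hd⟩ := hMX.exists_isHomotopyCellular_cone hL hMY φ'
    exact ⟨d, hd.of_quot_iso (c ≪≫ e)⟩

theorem dgFilt_le_dgPrae : dgFilt h𝒜 L ≤ dgPrae h𝒜 L := fun _ hX _ hP hPL =>
  hX.exists_isCellular.choose_spec.prop_of_isStrictTriangulated hP hPL

/-- Minimality of `dgPrae`, tested on the class of homotopy cellular objects. -/
theorem exists_dgFilt_of_dgPrae (hL : ∀ x, IsSimpleModule 𝒜.degZeroᵐᵒᵖ (L x)) (X : DGHot 𝒜)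
    (hX : dgPrae h𝒜 L X) : ∃ Y : DGHot 𝒜, dgFilt h𝒜 L Y ∧ Nonempty (X ≅ Y) := by
  obtain ⟨c, M, hM, ⟨e⟩⟩ := hX _ (isStrictTriangulated_isHomotopyCellular hL) fun x =>
    ⟨0, (isCellular_hat x).isHomotopyCellular⟩
  exact ⟨DGHot.quot.obj M, hM.hasHatFiltration, ⟨e⟩⟩

end Cellular

theorem theorem4p3 {k : Type u} [CommRing k] {A : Type v} [Ring A] [Algebra k A]
    (𝒜 : DGAlgebra k A) (h𝒜 : 𝒜.IsPositiveSemisimple)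
    {W : Type*} (L : W → Type v) [∀ x, AddCommGroup (L x)] [∀ x, Module 𝒜.degZeroᵐᵒᵖ (L x)]
    (hL : IsSimpleSystem 𝒜.degZero L) :
    (∀ X : DGHot 𝒜, dgPrae h𝒜 L X → ∃ Y : DGHot 𝒜, dgFilt h𝒜 L Y ∧ Nonempty (X ≅ Y)) ∧
    ∃ h : dgFilt h𝒜 L ≤ dgPrae h𝒜 L, (ObjectProperty.ιOfLE h).IsEquivalence := by
  -- An inclusion of full subcategories is fully faithful, so the equivalence amounts to essential
  -- surjectivity, which is the first assertion.
  refine ⟨exists_dgFilt_of_dgPrae hL.simple, dgFilt_le_dgPrae,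
    (ObjectProperty.isEquivalence_ιOfLE_iff _).2 fun X hX => ?_⟩
  obtain ⟨Y, hY, ⟨e⟩⟩ := exists_dgFilt_of_dgPrae hL.simple X hX
  exact ⟨Y, hY, ⟨e⟩⟩
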